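/- Let $G$ be any group and let $\{\sigma_j \mid j\in J\}$ be any collection (possibly infinite) of pairwise non-isomorphic splittings of $G$. Suppose that $\{\sigma_j\}$ satisfies sandwiching, and that $T_1$ and $T_2$ are algebraic regular neighborhoods of $\{\sigma_j \mid j\in J\}$. Then there exists a $G$-equivariant, color-preserving isomorphism from $T_1$ to $T_2$. Here the terms have the following meaning. **Trees and splittings.** A *$G$-tree* is a simplicial tree with a simplicial $G$-action that inverts no edge. It is *minimal* if it has no proper nonempty $G$-invariant subtree. A *splitting* of $G$ is a $G$-tree without global fixed point whose quotient graph has exactly one edge; it is a splitting *over* the stabilizer $H$ of an edge. Two splittings are *isomorphic* if there is a $G$-equivariant isomorphism between their trees. **Almost invariant sets.** A set $X\subset G$ *arises from* a splitting $\sigma$ if $X=\{g\in G \mid e \text{ points away from } gv\}$ for some vertex $v$ and directed edge $e$ of the tree of $\sigma$. Write $X^*=G\setminus X$, $\Sigma(X)=\{gX,\,gX^* \mid g\in G\}$ and $\mathrm{Stab}(X)=\{g \mid gX=X\}$. The *corners* of $(X,Y)$ are $X\cap Y$, $X\cap Y^*$, $X^*\cap Y$, $X^*\cap Y^*$. A subset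 of $G$ is *$H$-finite* if it lies in finitely many cosets $Hg$. $X$ *crosses* $Y$ if no corner of $(X,Y)$ is $\mathrm{Stab}(Y)$-finite. A corner of $(A,B)$ is *small* if it is $\mathrm{Stab}(A)$-finite, and $A\le B$ means that $A\cap B^*$ is empty or is the only small corner of $(A,B)$. **Intersection number and sandwiching.** Let $X$, $Y$ arise from $\sigma$, $\tau$, with stabilizers $H$, $K$. The intersection number $i(\sigma,\tau)$ is the number of double cosets $KgH$ such that $gX$ crosses $Y$. $\sigma$ is *sandwiched by* $\tau$ if either there are $A,B\in\Sigma(Y)$ with $A\le X\le B$, or $X$ crosses every element of $\Sigma(Y)$. (Whether $i(\sigma,\tau)=0$ and whether $\sigma$ is sandwiched by $\tau$ do not depend on the choice of $X$ and $Y$.) The collection $\{\sigma_j\}$ *satisfies sandwiching* if $\sigma_j$ is sandwiched by $\sigma_k$ for all $j,k\in J$. The splitting $\sigma_j$ is *isolated* if $i(\sigma_j,\sigma_k)=0$ for all $k\ne j$. **Enclosing.** Let $v$ be a vertex of a $G$-tree $T$ and $\sigma$ a splitting. The orbit of $v$ *encloses* $\sigma$ if there are a $G$-tree $T'$ and a $G$-orbit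 of edges of $T'$ (the $\sigma$-edges) such that collapsing all non-$\sigma$-edges of $T'$ gives a tree $G$-isomorphic to the tree of $\sigma$, and collapsing all $\sigma$-edges gives a tree $G$-isomorphic to $T$, the $\sigma$-edges being collapsed to vertices in the orbit of $v$. A vertex of a $G$-tree is *isolated* if it has valence two in the tree and its image has valence two in the quotient graph. **Algebraic regular neighborhoods.** An *algebraic regular neighborhood* of $\{\sigma_j\}$ is a $G$-tree $T$ with a $G$-invariant coloring of the vertices by two colors $V_0,V_1$, the ends of each edge having different colors, such that: 1. each $\sigma_j$ is enclosed by some $V_0$-vertex orbit, and each $V_0$-vertex orbit encloses some $\sigma_j$; 2. every splitting $\sigma$ of $G$ such that, for all $j\in J$, $\sigma$ is sandwiched by $\sigma_j$ and $i(\sigma,\sigma_j)=0$, is enclosed by some $V_1$-vertex orbit; 3. $T$ is minimal; 4. there is a bijection $f$ from $\{j\in J \mid \sigma_j \text{ is isolated}\}$ to the set of $G$-orbits of isolated $V_0$-vertices of $T$ such that $f(j)$ encloses $\sigma_j$ for every such $j$; 5. every orbit of non-isolated $V_0$-vertices encloses some non-isolated $\sigma_j$. -/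

import Mathlib

open scoped Pointwise

universe u w

/-! ## Trees with a group action -/

/-- A `G`-tree: a (nonempty) simplicial tree with a simplicial `G`-action without edge
inversions.  A tree has neither loops nor multiple edges, so it is a simple graph. -/
structure GTree (G : Type u) [Group G] where
  V : Type u
  graph : SimpleGraph V
  isTree : graph.IsTree
  action : MulAction G V
  smul_adj : ∀ (g : G) (a b : V), graph.Adj a b → graph.Adj (g • a) (g • b)
  no_inversion : ∀ (g : G) (a b : V), graph.Adj a b → ¬ (g • a = b ∧ g • b = a)

attribute [instance] GTree.action

namespace GTree

variable {G : Type u} [Group G]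

/-- `φ` is an isomorphism of `G`-trees. -/
def IsEquivariant {T T' : GTree G} (φ : T.graph ≃g T'.graph) : Prop :=
  ∀ (g : G) (v : T.V), φ (g • v) = g • φ v

/-- Two `G`-trees are `G`-equivariantly isomorphic. -/
def Isomorphic (T T' : GTree G) : Prop :=
  ∃ φ : T.graph ≃g T'.graph, IsEquivariant φ

/-- The `G`-orbit of the (undirected) edge `{a, b}`. -/
def edgeOrbit (T : GTree G) (a b : T.V) : Set (Sym2 T.V) :=
  {e | ∃ g : G, e = s(g • a, g • b)}

/-- `π` identifies `T'` with the quotient of `T` in which every edge belonging to `S` is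
collapsed to a point: `π` is equivariant and onto, its point preimages are exactly the connected
components of the union of the edges in `S`, and the edges of `T'` are exactly the images of the
edges of `T` that are not in `S`. -/
structure IsCollapse (T T' : GTree G) (S : Set (Sym2 T.V)) (π : T.V → T'.V) : Prop where
  equivariant : ∀ (g : G) (x : T.V), π (g • x) = g • π x
  surjective : Function.Surjective π
  eq_iff : ∀ x y : T.V,
    π x = π y ↔ (SimpleGraph.fromEdgeSet (T.graph.edgeSet ∩ S)).Reachable x y
  adj_iff : ∀ p q : T'.V,
    T'.graph.Adj p q ↔ ∃ x y : T.V, π x = p ∧ π y = q ∧ T.graph.Adj x y ∧ s(x, y) ∉ S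

/-- A `G`-tree is minimal if it has no proper (nonempty) `G`-invariant subtree. -/
def IsMinimal (T : GTree G) : Prop :=
  ∀ S : Set T.V, (∀ (g : G), ∀ x ∈ S, g • x ∈ S) → (T.graph.induce S).Connected → S = Set.univ

/-- A vertex is isolated if it has valence two in the tree and its image has valence two in the
quotient graph.  The valence of the image of `v` in the quotient graph (which may have
multiple edges) is the number of orbits of the stabilizer of `v` on the edges at `v`, that is, on
the neighbours of `v`. -/
def IsIsolatedVertex (T : GTree G) (v : T.V) : Prop :=
  (T.graph.neighborSet v).encard = 2 ∧
  {O : Set T.V | ∃ x, T.graph.Adj v x ∧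
    O = MulAction.orbit (MulAction.stabilizer G v) x}.encard = 2

end GTree

/-- A splitting of `G`: a `G`-tree without global fixed point, whose quotient graph has exactly one
edge. -/
structure Splitting (G : Type u) [Group G] extends GTree G where
  no_fixed_point : ¬ ∃ v : V, ∀ g : G, g • v = v
  exists_edge : ∃ a b : V, graph.Adj a b
  edges_one_orbit : ∀ a b c d : V, graph.Adj a b → graph.Adj c d →
    ∃ g : G, s(g • a, g • b) = s(c, d)

/-! ## Subsets of a group: crossing, almost inclusion, sandwiching -/

section Subsets

variable {G : Type u} [Group G]

/-- `A` is `H`-finite: it is contained in finitely many cosets `H g`. -/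
def CosetFinite (H : Subgroup G) (A : Set G) : Prop :=
  ∃ F : Set G, F.Finite ∧ A ⊆ ⋃ g ∈ F, (H : Set G) * {g}

/-- `X` crosses `Y`: no corner of the pair `(X, Y)` is `Stab(Y)`-finite. -/
def Crosses (X Y : Set G) : Prop :=
  ¬ CosetFinite (MulAction.stabilizer G Y) (X ∩ Y) ∧
  ¬ CosetFinite (MulAction.stabilizer G Y) (X ∩ Yᶜ) ∧
  ¬ CosetFinite (MulAction.stabilizer G Y) (Xᶜ ∩ Y) ∧
  ¬ CosetFinite (MulAction.stabilizer G Y) (Xᶜ ∩ Yᶜ)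

/-- `Σ(X)`, the set of all translates of `X` and of its complement. -/
def translates (X : Set G) : Set (Set G) :=
  {A | ∃ g : G, A = g • X ∨ A = g • Xᶜ}

/-- Almost inclusion `A ≤ B`: the corner `A ∩ Bᶜ` is empty, or it is the only small corner of
the pair `(A, B)`; a corner is small if it is `Stab(A)`-finite. -/
def AlmostLE (A B : Set G) : Prop :=
  A ∩ Bᶜ = ∅ ∨
    (CosetFinite (MulAction.stabilizer G A) (A ∩ Bᶜ) ∧
      ¬ CosetFinite (MulAction.stabilizer G A) (A ∩ B) ∧
      ¬ CosetFinite (MulAction.stabilizer G A) (Aᶜ ∩ B) ∧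
      ¬ CosetFinite (MulAction.stabilizer G A) (Aᶜ ∩ Bᶜ))

/-- `X` is sandwiched by `Y`. -/
def SandwichedSet (X Y : Set G) : Prop :=
  (∃ A ∈ translates Y, ∃ B ∈ translates Y, AlmostLE A X ∧ AlmostLE X B) ∨
    ∀ B ∈ translates Y, Crosses X B

/-- The number of double cosets `K g H` such that `g X` crosses `Y`, where `H = Stab(X)` and
`K = Stab(Y)`. -/
noncomputable def crossingNumber (X Y : Set G) : ℕ∞ :=
  {D : Set G | ∃ g : G,
    D = (MulAction.stabilizer G Y : Set G) * {g} * (MulAction.stabilizer G X : Set G) ∧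
      Crosses (g • X) Y}.encard

end Subsets

namespace Splitting

variable {G : Type u} [Group G]

/-- `X` is a standard almost invariant set arising from `σ`: for some base vertex `v` and some
directed edge `e` from `a` to `b`, it is the set of all `g` such that `e` points away from `g v`.
(The stabilizer of such a set `X` is the stabilizer of `e`.) -/
def Yields (σ : Splitting G) (X : Set G) : Prop :=
  ∃ v a b : σ.V, σ.graph.Adj a b ∧
    X = {g : G | σ.graph.dist (g • v) a < σ.graph.dist (g • v) b}

/-- `σ` is sandwiched by `τ`.  (The choice of `X` and `Y` does not matter.) -/
def SandwichedBy (σ τ : Splitting G) : Prop :=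
  ∃ X Y : Set G, σ.Yields X ∧ τ.Yields Y ∧ SandwichedSet X Y

/-- `σ` and `τ` have intersection number zero.  (The choice of `X` and `Y` does not matter.) -/
def IntersectionNumberZero (σ τ : Splitting G) : Prop :=
  ∃ X Y : Set G, σ.Yields X ∧ τ.Yields Y ∧ crossingNumber X Y = 0

variable {J : Type w}

/-- A family of splittings satisfies sandwiching.  (The choice of the `X j` does not matter.) -/
def SatisfiesSandwiching (σ : J → Splitting G) : Prop :=
  ∃ X : J → Set G, (∀ j, (σ j).Yields (X j)) ∧ ∀ j k, SandwichedSet (X j) (X k)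

/-- `σ j` is isolated in the family: it has intersection number zero with each other member. -/
def IsIsolated (σ : J → Splitting G) (j : J) : Prop :=
  ∀ k, k ≠ j → (σ j).IntersectionNumberZero (σ k)

end Splitting

/-- The orbit of the vertex `v` of `T` encloses `σ`: there are a `G`-tree `T'` and an orbit of edges
of `T'`, the `σ`-edges, such that collapsing all other edges gives a tree for `σ`, and collapsing
the `σ`-edges gives `T`, where the `σ`-edges are collapsed into the orbit of `v`. -/
def GTree.Encloses {G : Type u} [Group G] (T : GTree G) (v : T.V) (σ : Splitting G) : Prop :=
  ∃ (T' : GTree G) (a b : T'.V), T'.graph.Adj a b ∧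
    (∃ ρ : T'.V → σ.V, GTree.IsCollapse T' σ.toGTree (T'.edgeOrbit a b)ᶜ ρ) ∧
    ∃ π : T'.V → T.V, GTree.IsCollapse T' T (T'.edgeOrbit a b) π ∧ π a ∈ MulAction.orbit G v

/-! ## Algebraic regular neighborhoods -/

/-- A bipartite `G`-tree: the vertices are colored by `V₀` and `V₁` (the complement of `V₀`), the
coloring is `G`-invariant, and the ends of each edge have different colors. -/
structure BipartiteGTree (G : Type u) [Group G] extends GTree G where
  V₀ : Set V
  smul_mem : ∀ (g : G) (v : V), g • v ∈ V₀ ↔ v ∈ V₀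
  adj_color : ∀ a b : V, graph.Adj a b → (a ∈ V₀ ↔ b ∉ V₀)

namespace BipartiteGTree

variable {G : Type u} [Group G]

/-- The set of `G`-orbits of isolated `V₀`-vertices. -/
def isolatedOrbits (T : BipartiteGTree G) : Set (Set T.V) :=
  {O | ∃ v ∈ T.V₀, T.IsIsolatedVertex v ∧ O = MulAction.orbit G v}

/-- `T` is an algebraic regular neighborhood of the family `σ` of splittings. -/
structure IsAlgebraicRegularNeighborhood {J : Type w} (σ : J → Splitting G)
    (T : BipartiteGTree G) : Prop where
  enclosed_V₀ : ∀ j, ∃ v ∈ T.V₀, T.Encloses v (σ j)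
  V₀_encloses : ∀ v ∈ T.V₀, ∃ j, T.Encloses v (σ j)
  enclosed_V₁ : ∀ τ : Splitting G,
    (∀ j, τ.SandwichedBy (σ j) ∧ τ.IntersectionNumberZero (σ j)) →
      ∃ v, v ∉ T.V₀ ∧ T.Encloses v τ
  minimal : T.IsMinimal
  isolated : ∃ f : {j : J // Splitting.IsIsolated σ j} → T.isolatedOrbits,
    Function.Bijective f ∧ ∀ j, ∀ v ∈ (f j : Set T.V), T.Encloses v (σ j)
  non_isolated : ∀ v ∈ T.V₀, ¬ T.IsIsolatedVertex v →
    ∃ j, ¬ Splitting.IsIsolated σ j ∧ T.Encloses v (σ j)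

end BipartiteGTree

/-!
A bipartite tree without leaves is determined by its `V₀`-vertices and the betweenness relation
among them (`BipartiteGTree.Correspondence.exists_isomorphism`): a `V₁`-vertex is the common
neighbour of `V₀`-vertices that have no other `V₀`-vertex between them.  In an algebraic regular
neighborhood every `V₀`-vertex is the place where some edge of the tree of some `σ j` is enclosed
(`BipartiteGTree.IsAlgebraicRegularNeighborhood.exists_marking`).  So it suffices that the
betweenness of these places is the same in both trees (`BipartiteGTree.Marking.between_imp`).

To compare the trees, call a set of vertices large if any two vertices can be moved into it by one
group element.  Halves of the tree of a splitting and of a minimal tree are large: some `h` moves a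
half strictly into itself, and powers of `h` do the rest (`GTree.isLarge_half`).  Let an edge `f` of
a minimal tree `T` and an edge `s` of an enclosed splitting be given; they are nested in the common
refinement.  If `f` and `s` define non-isomorphic splittings, then the region between them is large
as well, since otherwise nothing can branch off between them
(`GTree.isomorphic_of_not_isLarge`).  Hence three of the four corners of `f` and `s` are large, and
the side of `f` on which `s` lies can be read off from the actions on the two collapsed trees,
without reference to the refinement.

Now suppose that an edge `f` of `T₂` separates the place of `s''` from those of `s` and `s'`.  The
splitting given by `f` is sandwiched by all `σ j` and has intersection number zero with them
(`GTree.edgeSplitting_compatible`), so `f` can be inserted in `T₁` at a `V₁`-vertex.  By the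
preceding paragraph `f` separates the places of `s''` and of `s`, `s'` in `T₁` too, and as these are
`V₀`-vertices, some edge of `T₁` does as well.

The argument needs care where `f` is isomorphic to one of the `σ j`, which is then isolated.  At an
isolated vertex the two edges give splittings isomorphic to the enclosed one
(`GTree.Enclosure.exists_isolatedSides`), so an isolated splitting in the middle can be replaced by
an edge of the tree (`BipartiteGTree.Marking.between_of_isolated`).  If none of the isolated places
separates `s''` from `s` and `s'`, branching on the side of `s` and `s'` still makes the region
between `f` and `s` large (`GTree.Enclosure.isLarge_inter_of_not_between`).
-/

/-! ### Halves of a tree -/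

section Halves

variable {V : Type*} {Γ : SimpleGraph V}

/-- The half `half Γ a b` of `Γ` cut off by the edge `{a, b}`, on the side of `a`: the connected
component of `a` in the graph `Γ` with that edge removed. -/
def half (Γ : SimpleGraph V) (a b : V) : Set V :=
  {x | (Γ.deleteEdges {s(a, b)}).Reachable x a}

theorem left_mem_half (a b : V) : a ∈ half Γ a b := SimpleGraph.Reachable.refl a

theorem mem_half_of_adj {a b x y : V} (hxy : Γ.Adj x y) (hne : s(x, y) ≠ s(a, b))
    (hy : y ∈ half Γ a b) : x ∈ half Γ a b := by
  have h : (Γ.deleteEdges {s(a, b)}).Adj x y := by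
    simpa [SimpleGraph.deleteEdges_adj] using And.intro hxy hne
  exact h.reachable.trans hy

theorem mem_half_congr {a b x y : V} (hxy : Γ.Adj x y) (hne : s(x, y) ≠ s(a, b)) :
    x ∈ half Γ a b ↔ y ∈ half Γ a b :=
  ⟨mem_half_of_adj hxy.symm (by rwa [Sym2.eq_swap]), mem_half_of_adj hxy hne⟩

theorem half_induction {a b : V} {P : V → Prop} (ha : P a)
    (hstep : ∀ x y, Γ.Adj x y → s(x, y) ≠ s(a, b) → y ∈ half Γ a b → P y → P x) :
    ∀ x ∈ half Γ a b, P x := by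
  have key : ∀ {x z : V}, (Γ.deleteEdges {s(a, b)}).Walk x z → z = a → P x := by
    intro x z w
    induction w with
    | nil => rintro rfl; exact ha
    | @cons x y z h q ih =>
      intro hz
      have h' := SimpleGraph.deleteEdges_adj.1 h
      exact hstep x y h'.1 (by simpa using h'.2) (hz ▸ q.reachable) (ih hz)
  exact fun x ⟨w⟩ => key w rfl

theorem mem_half_or (hΓ : Γ.IsTree) (a b x : V) : x ∈ half Γ a b ∨ x ∈ half Γ b a := by
  obtain ⟨w⟩ := hΓ.connected.preconnected x a
  induction w with
  | nil => exact Or.inl (left_mem_half _ _)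
  | @cons x y a h q ih =>
    by_cases hne : s(x, y) = s(a, b)
    · rcases Sym2.eq_iff.1 hne with ⟨rfl, -⟩ | ⟨rfl, -⟩
      · exact Or.inl (left_mem_half _ _)
      · exact Or.inr (left_mem_half _ _)
    · exact ih.imp (mem_half_of_adj h hne)
        (mem_half_of_adj h (by rwa [Sym2.eq_swap (a := b)]))

theorem notMem_half_swap (hΓ : Γ.IsTree) {a b x : V} (hab : Γ.Adj a b) (hx : x ∈ half Γ a b) :
    x ∉ half Γ b a := by
  intro hx'
  have hb := (SimpleGraph.isAcyclic_iff_forall_adj_isBridge.1 hΓ.isAcyclic) hab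
  rw [SimpleGraph.isBridge_iff] at hb
  refine hb ?_
  have h1 : (Γ.deleteEdges {s(a, b)}).Reachable x b := by
    have := hx'
    rwa [half, Set.mem_ofPred_eq, Sym2.eq_swap] at this
  exact (SimpleGraph.Reachable.symm hx).trans h1

theorem mem_half_swap (hΓ : Γ.IsTree) {a b x : V} (hab : Γ.Adj a b) :
    x ∈ half Γ b a ↔ x ∉ half Γ a b :=
  ⟨notMem_half_swap hΓ hab.symm, fun h => (mem_half_or hΓ a b x).resolve_left h⟩

theorem notMem_half_of_mem (hΓ : Γ.IsTree) {a b : V} (hab : Γ.Adj a b) : b ∉ half Γ a b :=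
  notMem_half_swap hΓ hab.symm (left_mem_half b a)

/-- Nesting: if each of two edges lies on a given side of the other, then the two remaining halves
are nested. -/
theorem half_subset_half (hΓ : Γ.IsTree) {a b c d : V} (hab : Γ.Adj a b)
    (hne : s(a, b) ≠ s(c, d)) (hc : c ∈ half Γ a b) (ha : a ∈ half Γ c d) :
    half Γ b a ⊆ half Γ c d := by
  refine half_induction (mem_half_of_adj hab.symm (by rwa [Sym2.eq_swap]) ha) ?_
  intro x y hxy hxy' hy ih
  refine mem_half_of_adj hxy ?_ ih
  intro h
  have hx : x ∈ half Γ b a := mem_half_of_adj hxy hxy' hy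
  have hc' := notMem_half_swap hΓ hab hc
  rcases Sym2.eq_iff.1 h with ⟨rfl, -⟩ | ⟨-, rfl⟩
  · exact hc' hx
  · exact hc' hy

theorem mem_edges_of_mem_half {a b x y : V} (hx : x ∈ half Γ a b) (hy : y ∉ half Γ a b)
    (w : Γ.Walk x y) : s(a, b) ∈ w.edges := by
  refine w.mem_edges_of_not_reachable_deleteEdges ?_
  intro h
  exact hy (h.symm.trans hx)

theorem dist_lt_of_mem_half (hΓ : Γ.IsTree) {p q x y : V} (hpq : Γ.Adj p q)
    (hx : x ∈ half Γ q p) (hy : y ∈ half Γ p q) : Γ.dist p y < Γ.dist x y := by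
  classical
  obtain ⟨w, hw⟩ := hΓ.connected.exists_walk_length_eq_dist x y
  have he := mem_edges_of_mem_half hx (notMem_half_swap hΓ hpq hy) w
  have hp : p ∈ w.support := w.snd_mem_support_of_mem_edges he
  have hne : p ≠ x := by
    rintro rfl
    exact notMem_half_of_mem hΓ hpq.symm hx
  calc Γ.dist p y ≤ (w.dropUntil p hp).length := SimpleGraph.dist_le _
    _ < w.length := SimpleGraph.Walk.length_dropUntil_lt_length hp hne
    _ = _ := hw

theorem mem_half_iff_dist (hΓ : Γ.IsTree) {a b x : V} (hab : Γ.Adj a b) :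
    x ∈ half Γ a b ↔ Γ.dist x a < Γ.dist x b := by
  constructor
  · intro h
    have := dist_lt_of_mem_half hΓ hab (left_mem_half b a) h
    rwa [SimpleGraph.dist_comm, SimpleGraph.dist_comm (u := b)] at this
  · intro h
    by_contra hx
    have := dist_lt_of_mem_half hΓ hab.symm (left_mem_half a b) ((mem_half_swap hΓ hab).2 hx)
    rw [SimpleGraph.dist_comm, SimpleGraph.dist_comm (u := a)] at this
    omega

theorem exists_dist_lt (hΓ : Γ.IsTree) {x y : V} (hxy : x ≠ y) :
    ∃ x', Γ.Adj x x' ∧ Γ.dist x' y < Γ.dist x y := by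
  obtain ⟨w, hw⟩ := hΓ.connected.exists_walk_length_eq_dist x y
  cases w with
  | nil => exact absurd rfl hxy
  | @cons _ x' _ h q =>
    refine ⟨x', h, ?_⟩
    rw [← hw, SimpleGraph.Walk.length_cons]
    exact Nat.lt_succ_of_le (SimpleGraph.dist_le q)

/-- Two distinct vertices are separated by the first edge on the way from one to the other. -/
theorem exists_adj_mem_half (hΓ : Γ.IsTree) {x y : V} (hxy : x ≠ y) :
    ∃ x', Γ.Adj x x' ∧ y ∈ half Γ x' x := by
  obtain ⟨x', h, hlt⟩ := exists_dist_lt hΓ hxy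
  refine ⟨x', h, (mem_half_iff_dist hΓ h.symm).2 ?_⟩
  rwa [SimpleGraph.dist_comm, SimpleGraph.dist_comm (u := y)]

theorem half_eq_of_edge_eq {a b c d : V} (h : s(a, b) = s(c, d)) :
    half Γ a b = half Γ c d ∨ half Γ a b = half Γ d c := by
  rcases Sym2.eq_iff.1 h with ⟨rfl, rfl⟩ | ⟨rfl, rfl⟩
  · exact Or.inl rfl
  · exact Or.inr rfl

/-- Two vertices of a tree are joined by a path of edges in `S` if and only if every edge that
separates them belongs to `S`. -/
theorem reachable_iff_separating (hΓ : Γ.IsTree) (S : Set (Sym2 V)) (x y : V) :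
    (SimpleGraph.fromEdgeSet (Γ.edgeSet ∩ S)).Reachable x y ↔
      ∀ a b, Γ.Adj a b → x ∈ half Γ a b → y ∉ half Γ a b → s(a, b) ∈ S := by
  constructor
  · rintro ⟨w⟩ a b hab hx hy
    induction w with
    | nil => exact absurd hx hy
    | @cons x z y h q ih =>
      have h' := (SimpleGraph.fromEdgeSet_adj _).1 h
      have hadj : Γ.Adj x z := h'.1.1
      by_cases hne : s(x, z) = s(a, b)
      · exact hne ▸ h'.1.2
      · exact ih ((mem_half_congr hadj hne).1 hx) hy
  · intro H
    induction hn : Γ.dist x y using Nat.strong_induction_on generalizing x with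
    | _ n ih =>
      by_cases hxy : x = y
      · subst hxy; exact SimpleGraph.Reachable.refl _
      · obtain ⟨x', hadj, hlt⟩ := exists_dist_lt hΓ hxy
        have hy : y ∈ half Γ x' x := by
          refine (mem_half_iff_dist hΓ hadj.symm).2 ?_
          rwa [SimpleGraph.dist_comm, SimpleGraph.dist_comm (u := y)]
        have hyn := notMem_half_swap hΓ hadj.symm hy
        have hS := H x x' hadj (left_mem_half _ _) hyn
        have h1 : (SimpleGraph.fromEdgeSet (Γ.edgeSet ∩ S)).Adj x x' :=
          (SimpleGraph.fromEdgeSet_adj _).2 ⟨⟨hadj, hS⟩, hadj.ne⟩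
        refine h1.reachable.trans (ih _ (hn ▸ hlt) x' ?_ rfl)
        intro a b hab hx' hya
        by_cases hne : s(x, x') = s(a, b)
        · rw [← hne]; exact hS
        · exact H a b hab ((mem_half_congr hadj hne).2 hx') hya

theorem mem_half_map {V' : Type*} {Γ' : SimpleGraph V'} (φ : Γ ≃g Γ') {a b : V} :
    ∀ x ∈ half Γ a b, φ x ∈ half Γ' (φ a) (φ b) := by
  refine half_induction (left_mem_half _ _) ?_
  intro x y hxy hne _ ih
  refine mem_half_of_adj (φ.map_adj_iff.2 hxy) ?_ ih
  intro h
  apply hne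
  have h2 : Sym2.map φ s(x, y) = Sym2.map φ s(a, b) := by simpa using h
  exact Sym2.map.injective φ.injective h2

theorem mem_half_map_iff {V' : Type*} {Γ' : SimpleGraph V'} (φ : Γ ≃g Γ') {a b x : V} :
    φ x ∈ half Γ' (φ a) (φ b) ↔ x ∈ half Γ a b := by
  refine ⟨fun h => ?_, mem_half_map φ x⟩
  simpa using mem_half_map φ.symm _ h

end Halves

/-! ### Trees with a group action -/

/-- A subset of a `G`-set is large if any two points can be moved into it simultaneously by an
element of `G`. -/
def IsLarge (G : Type*) [Group G] {V : Type*} [MulAction G V] (U : Set V) : Prop :=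
  ∀ x y : V, ∃ g : G, g • x ∈ U ∧ g • y ∈ U

theorem IsLarge.mono {G : Type*} [Group G] {V : Type*} [MulAction G V] {U W : Set V}
    (hU : IsLarge G U) (h : U ⊆ W) : IsLarge G W := fun x y =>
  let ⟨g, hx, hy⟩ := hU x y
  ⟨g, h hx, h hy⟩

namespace GTree

variable {G : Type u} [Group G]

/-- An element of `G` as an automorphism of the graph underlying a `G`-tree. -/
def smulIso (T : GTree G) (g : G) : T.graph ≃g T.graph where
  toEquiv := MulAction.toPerm g
  map_rel_iff' := by
    intro a b
    refine ⟨fun h => ?_, T.smul_adj g a b⟩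
    simpa using T.smul_adj g⁻¹ _ _ h

theorem adj_smul (T : GTree G) (g : G) {a b : T.V} :
    T.graph.Adj (g • a) (g • b) ↔ T.graph.Adj a b := (T.smulIso g).map_adj_iff

theorem smul_mem_half_smul (T : GTree G) (g : G) {a b x : T.V} :
    g • x ∈ half T.graph (g • a) (g • b) ↔ x ∈ half T.graph a b :=
  mem_half_map_iff (T.smulIso g)

theorem smul_mem_half (T : GTree G) (g : G) {a b x : T.V} :
    g • x ∈ half T.graph a b ↔ x ∈ half T.graph (g⁻¹ • a) (g⁻¹ • b) := by
  have h := T.smul_mem_half_smul g (a := g⁻¹ • a) (b := g⁻¹ • b) (x := x)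
  rwa [smul_inv_smul, smul_inv_smul] at h

theorem mem_half_smul (T : GTree G) (g : G) {a b x : T.V} :
    x ∈ half T.graph (g • a) (g • b) ↔ g⁻¹ • x ∈ half T.graph a b := by
  rw [T.smul_mem_half, inv_inv]

theorem dist_smul (T : GTree G) (g : G) (x y : T.V) :
    T.graph.dist (g • x) (g • y) = T.graph.dist x y := by
  have key : ∀ (g : G) (x y : T.V), T.graph.dist (g • x) (g • y) ≤ T.graph.dist x y := by
    intro g x y
    obtain ⟨w, hw⟩ := T.isTree.connected.exists_walk_length_eq_dist x y
    rw [← hw, ← SimpleGraph.Walk.length_map (T.smulIso g).toHom w]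
    exact SimpleGraph.dist_le _
  refine le_antisymm (key g x y) ?_
  simpa using key g⁻¹ (g • x) (g • y)

theorem smul_edge_ne (T : GTree G) (g : G) {a b c d : T.V} (h : s(a, b) ≠ s(c, d)) :
    s(g • a, g • b) ≠ s(g • c, g • d) := by
  intro h'
  apply h
  have h2 : Sym2.map (g • · : T.V → T.V) s(a, b) = Sym2.map (g • ·) s(c, d) := by simpa using h'
  exact Sym2.map.injective (MulAction.injective g) h2

theorem smul_eq_of_edge_eq (T : GTree G) {g : G} {a b : T.V} (hab : T.graph.Adj a b)
    (h : s(g • a, g • b) = s(a, b)) : g • a = a ∧ g • b = b := by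
  rcases Sym2.eq_iff.1 h with h | h
  · exact h
  · exact absurd h (T.no_inversion g a b hab)

theorem self_mem_edgeOrbit (T : GTree G) (g : G) (a b : T.V) :
    s(g • a, g • b) ∈ T.edgeOrbit a b := ⟨g, rfl⟩

theorem smul_mem_edgeOrbit (T : GTree G) (g : G) {a b x y : T.V} :
    s(g • x, g • y) ∈ T.edgeOrbit a b ↔ s(x, y) ∈ T.edgeOrbit a b := by
  have key : ∀ (g : G) {x y : T.V}, s(x, y) ∈ T.edgeOrbit a b →
      s(g • x, g • y) ∈ T.edgeOrbit a b := by
    rintro g x y ⟨k, hk⟩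
    refine ⟨g * k, ?_⟩
    rcases Sym2.eq_iff.1 hk with ⟨rfl, rfl⟩ | ⟨rfl, rfl⟩
    · simp [mul_smul]
    · rw [Sym2.eq_swap]; simp [mul_smul]
  exact ⟨fun h => by simpa using key g⁻¹ h, key g⟩

theorem edgeOrbit_smul (T : GTree G) (g : G) (a b : T.V) :
    T.edgeOrbit (g • a) (g • b) = T.edgeOrbit a b := by
  ext e
  constructor
  · rintro ⟨k, rfl⟩; exact ⟨k * g, by simp [mul_smul]⟩
  · rintro ⟨k, rfl⟩; exact ⟨k * g⁻¹, by simp [mul_smul]⟩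

theorem edgeOrbit_swap (T : GTree G) (a b : T.V) : T.edgeOrbit b a = T.edgeOrbit a b := by
  ext e
  constructor
  · rintro ⟨k, rfl⟩; exact ⟨k, Sym2.eq_swap⟩
  · rintro ⟨k, rfl⟩; exact ⟨k, Sym2.eq_swap⟩

theorem edgeOrbit_eq_of_mem (T : GTree G) {a b x y : T.V} (h : s(x, y) ∈ T.edgeOrbit a b) :
    T.edgeOrbit x y = T.edgeOrbit a b := by
  obtain ⟨g, hg⟩ := h
  rcases Sym2.eq_iff.1 hg with ⟨rfl, rfl⟩ | ⟨rfl, rfl⟩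
  · exact T.edgeOrbit_smul g a b
  · rw [T.edgeOrbit_swap, T.edgeOrbit_smul]

/-! ### Large halves -/

theorem exists_pow_smul_mem_half (T : GTree G) {a b : T.V} (hab : T.graph.Adj a b) {h : G}
    (hne : s(h • a, h • b) ≠ s(a, b)) (hsub : ∀ z ∈ half T.graph a b, h • z ∈ half T.graph a b)
    (x : T.V) : ∃ n : ℕ, h ^ n • x ∈ half T.graph a b := by
  induction hn : T.graph.dist x b using Nat.strong_induction_on generalizing x with
  | _ n ih =>
    by_cases hx : h • x ∈ half T.graph a b
    · exact ⟨1, by simpa using hx⟩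
    · have hb : h • b ∈ half T.graph a b :=
        (mem_half_congr ((T.adj_smul h).2 hab) hne).1 (hsub a (left_mem_half a b))
      have hlt := dist_lt_of_mem_half T.isTree hab.symm hb ((mem_half_swap T.isTree hab).2 hx)
      rw [T.dist_smul, SimpleGraph.dist_comm, SimpleGraph.dist_comm (u := b), hn] at hlt
      obtain ⟨m, hm⟩ := ih _ hlt (h • x) rfl
      exact ⟨m + 1, by rwa [pow_succ, mul_smul]⟩

/-- If `h` moves the half of `a` strictly into itself, that half is large: the powers of `h` move
every vertex into it eventually. -/
theorem isLarge_half_of_smul_subset (T : GTree G) {a b : T.V} (hab : T.graph.Adj a b) {h : G}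
    (hne : s(h • a, h • b) ≠ s(a, b)) (hsub : ∀ z ∈ half T.graph a b, h • z ∈ half T.graph a b) :
    IsLarge G (half T.graph a b) := by
  have hpow : ∀ (n : ℕ), ∀ z ∈ half T.graph a b, h ^ n • z ∈ half T.graph a b := by
    intro n
    induction n with
    | zero => intro z hz; simpa using hz
    | succ n ih => intro z hz; rw [pow_succ', mul_smul]; exact hsub _ (ih z hz)
  intro x y
  obtain ⟨n, hn⟩ := T.exists_pow_smul_mem_half hab hne hsub x
  obtain ⟨m, hm⟩ := T.exists_pow_smul_mem_half hab hne hsub y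
  refine ⟨h ^ (n + m), ?_, ?_⟩
  · rw [add_comm, pow_add, mul_smul]; exact hpow m _ hn
  · rw [pow_add, mul_smul]; exact hpow n _ hm

/-- If no vertex stays on the same side of all edges of an orbit under the whole group, then both
halves at each edge of this orbit are large. -/
theorem isLarge_half (T : GTree G) {a b : T.V} (hab : T.graph.Adj a b)
    (hfix : ∀ x : T.V, ∃ g h : G, ¬ (x ∈ half T.graph (h • a) (h • b) ↔
      g • x ∈ half T.graph (h • a) (h • b))) :
    IsLarge G (half T.graph a b) := by
  have hT := T.isTree
  have hadj : ∀ k : G, T.graph.Adj (k • a) (k • b) := fun k => (T.adj_smul k).2 hab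
  -- an element moving `b` across the edge, and one moving `a` across the edge
  obtain ⟨k₁, hk₁⟩ : ∃ k : G, k • b ∈ half T.graph a b := by
    by_contra! H
    obtain ⟨g, h, hgh⟩ := hfix b
    refine hgh (iff_of_false ?_ ?_)
    · rw [T.mem_half_smul]; exact H _
    · rw [T.mem_half_smul, ← mul_smul]; exact H _
  obtain ⟨k₂, hk₂⟩ : ∃ k : G, k • a ∉ half T.graph a b := by
    by_contra! H
    obtain ⟨g, h, hgh⟩ := hfix a
    refine hgh (iff_of_true ?_ ?_)
    · rw [T.mem_half_smul]; exact H _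
    · rw [T.mem_half_smul, ← mul_smul]; exact H _
  have hne₁ : s(k₁ • a, k₁ • b) ≠ s(a, b) := by
    intro h
    rw [(T.smul_eq_of_edge_eq hab h).2] at hk₁
    exact notMem_half_of_mem hT hab hk₁
  have hne₂ : s(k₂ • a, k₂ • b) ≠ s(a, b) := by
    intro h
    rw [(T.smul_eq_of_edge_eq hab h).1] at hk₂
    exact hk₂ (left_mem_half a b)
  have hk₁a : k₁ • a ∈ half T.graph a b := (mem_half_congr (hadj k₁) hne₁).2 hk₁
  have hk₂b : k₂ • b ∉ half T.graph a b := fun h => hk₂ ((mem_half_congr (hadj k₂) hne₂).2 h)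
  by_cases h1 : a ∈ half T.graph (k₁ • b) (k₁ • a)
  · refine T.isLarge_half_of_smul_subset hab hne₁ fun z hz => ?_
    refine half_subset_half hT (hadj k₁).symm ?_ h1 hk₁ ((T.smul_mem_half_smul k₁).2 hz)
    rwa [Sym2.eq_swap]
  have h1' : a ∈ half T.graph (k₁ • a) (k₁ • b) := (mem_half_swap hT (hadj k₁).symm).2 h1
  by_cases h2 : a ∈ half T.graph (k₂ • a) (k₂ • b)
  · refine T.isLarge_half_of_smul_subset (h := k₂⁻¹) hab ?_ fun z hz => ?_
    · have := T.smul_edge_ne k₂⁻¹ hne₂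
      rw [inv_smul_smul, inv_smul_smul] at this
      exact this.symm
    · rw [← T.mem_half_smul]
      refine half_subset_half hT hab.symm ?_ ((mem_half_swap hT hab).2 hk₂)
        ((mem_half_congr hab hne₂.symm).1 h2) hz
      rw [Sym2.eq_swap]; exact hne₂.symm
  have h2' : a ∈ half T.graph (k₂ • b) (k₂ • a) := (mem_half_swap hT (hadj k₂)).2 h2
  have hsub₂ : ∀ z ∈ half T.graph a b, k₂ • z ∈ half T.graph b a := by
    intro z hz
    refine half_subset_half hT (hadj k₂).symm ?_ ?_ ?_ ((T.smul_mem_half_smul k₂).2 hz)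
    · rw [Sym2.eq_swap, Sym2.eq_swap (a := b)]; exact hne₂
    · exact (mem_half_congr hab (by rw [Sym2.eq_swap (a := k₂ • b)]; exact hne₂.symm)).1 h2'
    · exact (mem_half_swap hT hab).2 hk₂b
  have hsub₁ : ∀ z ∈ half T.graph b a, k₁ • z ∈ half T.graph a b := by
    intro z hz
    exact half_subset_half hT (hadj k₁) hne₁ h1' hk₁a ((T.smul_mem_half_smul k₁).2 hz)
  refine T.isLarge_half_of_smul_subset (h := k₁ * k₂) hab ?_ fun z hz => ?_
  · intro h
    have h4 := (T.smul_eq_of_edge_eq hab h).2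
    -- `k₁ • a` lies in `k₁ k₂ • half a b = half a b`, hence `a ∈ k₂ • half a b`
    have h5 : k₁ • a ∈ half T.graph ((k₁ * k₂) • a) ((k₁ * k₂) • b) := by
      rw [(T.smul_eq_of_edge_eq hab h).1, h4]; exact hk₁a
    rw [mul_smul, mul_smul, T.smul_mem_half_smul] at h5
    exact h2 h5
  · rw [mul_smul]; exact hsub₁ _ (hsub₂ z hz)

/-! ### Collapsing edges -/

namespace IsCollapse

variable {T T' : GTree G} {S : Set (Sym2 T.V)} {π : T.V → T'.V}

theorem map_eq_iff (h : IsCollapse T T' S π) {x y : T.V} :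
    π x = π y ↔ ∀ a b, T.graph.Adj a b → x ∈ half T.graph a b → y ∉ half T.graph a b →
      s(a, b) ∈ S := by
  rw [h.eq_iff, reachable_iff_separating T.isTree]

theorem map_eq_of_mem (h : IsCollapse T T' S π) {x y : T.V} (hxy : T.graph.Adj x y)
    (hS : s(x, y) ∈ S) : π x = π y := by
  rw [h.eq_iff]
  refine SimpleGraph.Adj.reachable ?_
  exact (SimpleGraph.fromEdgeSet_adj _).2 ⟨⟨hxy, hS⟩, hxy.ne⟩

theorem map_adj (h : IsCollapse T T' S π) {x y : T.V} (hxy : T.graph.Adj x y)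
    (hS : s(x, y) ∉ S) : T'.graph.Adj (π x) (π y) :=
  (h.adj_iff _ _).2 ⟨x, y, rfl, rfl, hxy, hS⟩

theorem exists_lift (h : IsCollapse T T' S π) {p q : T'.V} (hpq : T'.graph.Adj p q) :
    ∃ x y, π x = p ∧ π y = q ∧ T.graph.Adj x y ∧ s(x, y) ∉ S := (h.adj_iff p q).1 hpq

theorem mem_half_congr_of_eq (h : IsCollapse T T' S π) {a b x y : T.V} (hab : T.graph.Adj a b)
    (hS : s(a, b) ∉ S) (hxy : π x = π y) : x ∈ half T.graph a b ↔ y ∈ half T.graph a b := by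
  constructor
  · intro hx
    by_contra hy
    exact hS (h.map_eq_iff.1 hxy a b hab hx hy)
  · intro hy
    by_contra hx
    exact hS (h.map_eq_iff.1 hxy.symm a b hab hy hx)

theorem lift_unique (h : IsCollapse T T' S π) {x y x' y' : T.V} (hxy : T.graph.Adj x y)
    (hS : s(x, y) ∉ S) (hxy' : T.graph.Adj x' y') (hx : π x' = π x) (hy : π y' = π y) :
    x' = x ∧ y' = y := by
  have h1 : x' ∈ half T.graph x y := (h.mem_half_congr_of_eq hxy hS hx).2 (left_mem_half x y)
  have h2 : y' ∉ half T.graph x y := fun hy' =>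
    notMem_half_of_mem T.isTree hxy ((h.mem_half_congr_of_eq hxy hS hy).1 hy')
  by_cases hne : s(x', y') = s(x, y)
  · rcases Sym2.eq_iff.1 hne with h' | ⟨rfl, rfl⟩
    · exact h'
    · exact absurd (left_mem_half _ _) h2
  · exact absurd ((mem_half_congr hxy' hne).1 h1) h2

/-- The halves of the collapsed tree pull back to the halves of the original tree. -/
theorem map_mem_half_iff (h : IsCollapse T T' S π) {x y z : T.V} (hxy : T.graph.Adj x y)
    (hS : s(x, y) ∉ S) :
    π z ∈ half T'.graph (π x) (π y) ↔ z ∈ half T.graph x y := by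
  have key : ∀ {x y : T.V}, T.graph.Adj x y → s(x, y) ∉ S → ∀ z ∈ half T.graph x y,
      π z ∈ half T'.graph (π x) (π y) := by
    intro x y hxy hS
    refine half_induction (left_mem_half _ _) ?_
    intro z z' hz hne _ ih
    by_cases hzS : s(z, z') ∈ S
    · rwa [h.map_eq_of_mem hz hzS]
    · refine mem_half_of_adj (h.map_adj hz hzS) ?_ ih
      intro heq
      apply hne
      rcases Sym2.eq_iff.1 heq with ⟨h1, h2⟩ | ⟨h1, h2⟩
      · obtain ⟨rfl, rfl⟩ := h.lift_unique hxy hS hz h1 h2; rfl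
      · obtain ⟨rfl, rfl⟩ := h.lift_unique hxy hS hz.symm h2 h1; exact Sym2.eq_swap
  refine ⟨fun hz => ?_, key hxy hS z⟩
  by_contra hz'
  refine notMem_half_swap T'.isTree (h.map_adj hxy hS) hz ?_
  exact key hxy.symm (by rwa [Sym2.eq_swap]) z ((mem_half_swap T.isTree hxy).2 hz')

theorem isLarge_preimage (h : IsCollapse T T' S π) {U : Set T'.V} (hU : IsLarge G U) :
    IsLarge G (π ⁻¹' U) := by
  intro x y
  obtain ⟨g, hx, hy⟩ := hU (π x) (π y)
  refine ⟨g, ?_, ?_⟩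
  · rwa [Set.mem_preimage, h.equivariant]
  · rwa [Set.mem_preimage, h.equivariant]

theorem isLarge_half (h : IsCollapse T T' S π) {x y : T.V} (hxy : T.graph.Adj x y)
    (hS : s(x, y) ∉ S) (hL : IsLarge G (half T'.graph (π x) (π y))) :
    IsLarge G (half T.graph x y) :=
  (h.isLarge_preimage hL).mono fun _ hz => (h.map_mem_half_iff hxy hS).1 hz

end IsCollapse

end GTree

theorem Splitting.isLarge_half {G : Type u} [Group G] (σ : Splitting G) {a b : σ.V}
    (hab : σ.graph.Adj a b) : IsLarge G (half σ.graph a b) := by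
  refine σ.toGTree.isLarge_half hab fun x => ?_
  have hx : ∃ g : G, g • x ≠ x := by
    by_contra! H
    exact σ.no_fixed_point ⟨x, H⟩
  obtain ⟨g, hg⟩ := hx
  obtain ⟨y, hxy, hy⟩ := exists_adj_mem_half σ.isTree hg.symm
  obtain ⟨h, hh⟩ := σ.edges_one_orbit a b x y hab hxy
  refine ⟨g, h, fun hiff => ?_⟩
  have hyn := notMem_half_swap σ.isTree hxy.symm hy
  rcases half_eq_of_edge_eq (Γ := σ.graph) hh with h' | h'
  · rw [h'] at hiff
    exact hyn (hiff.1 (left_mem_half x y))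
  · rw [h'] at hiff
    exact notMem_half_of_mem σ.isTree hxy.symm (hiff.2 hy)

namespace GTree

variable {G : Type u} [Group G]

/-! ### The splitting defined by an edge of a minimal tree -/

/-- Two vertices are equivalent if no translate of the edge `{a, b}` separates them. -/
def sideSetoid (T : GTree G) (a b : T.V) : Setoid T.V where
  r x y := ∀ h : G, x ∈ half T.graph (h • a) (h • b) ↔ y ∈ half T.graph (h • a) (h • b)
  iseqv := ⟨fun _ _ => Iff.rfl, fun H h => (H h).symm, fun H H' h => (H h).trans (H' h)⟩

theorem sideSetoid_smul (T : GTree G) {a b x y : T.V} (g : G) (h : T.sideSetoid a b x y) :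
    T.sideSetoid a b (g • x) (g • y) := by
  intro k
  have := h (g⁻¹ * k)
  rwa [mul_smul, mul_smul, ← T.smul_mem_half, ← T.smul_mem_half] at this

theorem sideSetoid_mem_half (T : GTree G) {a b x y c d : T.V} (hab : T.graph.Adj a b)
    (h : T.sideSetoid a b x y) (hcd : s(c, d) ∈ T.edgeOrbit a b) :
    x ∈ half T.graph c d ↔ y ∈ half T.graph c d := by
  obtain ⟨g, hg⟩ := hcd
  rcases Sym2.eq_iff.1 hg with ⟨rfl, rfl⟩ | ⟨rfl, rfl⟩
  · exact h g
  · rw [mem_half_swap T.isTree ((T.adj_smul g).2 hab),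
      mem_half_swap T.isTree ((T.adj_smul g).2 hab), h g]

theorem sideSetoid_of_adj (T : GTree G) {a b x y : T.V} (hxy : T.graph.Adj x y)
    (hS : s(x, y) ∉ T.edgeOrbit a b) : T.sideSetoid a b x y :=
  fun h => mem_half_congr hxy fun heq => hS ⟨h, heq⟩

theorem not_sideSetoid_of_adj (T : GTree G) {a b x y : T.V} (hab : T.graph.Adj a b)
    (hxy : T.graph.Adj x y) (hS : s(x, y) ∈ T.edgeOrbit a b) : ¬ T.sideSetoid a b x y := fun h =>
  notMem_half_of_mem T.isTree hxy ((T.sideSetoid_mem_half hab h hS).1 (left_mem_half x y))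

theorem IsMinimal.isLarge_half {T : GTree G} (hT : T.IsMinimal) {a b : T.V}
    (hab : T.graph.Adj a b) : IsLarge G (half T.graph a b) := by
  refine T.isLarge_half hab fun x => ?_
  by_contra! H
  -- the vertices on the same side as `x` of all edges of the orbit form an invariant subtree
  set S : Set T.V := {y | T.sideSetoid a b y x} with hS
  have huniv : S = Set.univ := by
    refine hT S ?_ ?_
    · intro g y hy
      exact (T.sideSetoid a b).trans (T.sideSetoid_smul g hy) fun h => (H g h).symm
    · have hxS : x ∈ S := (T.sideSetoid a b).refl x
      have key : ∀ (n : ℕ) (y : T.V) (hy : y ∈ S), T.graph.dist y x = n →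
          (T.graph.induce S).Reachable ⟨y, hy⟩ ⟨x, hxS⟩ := by
        intro n
        induction n using Nat.strong_induction_on with
        | _ n ih =>
          intro y hy hn
          by_cases hyx : y = x
          · subst hyx; exact SimpleGraph.Reachable.refl _
          obtain ⟨y', hadj, hlt⟩ := exists_dist_lt T.isTree hyx
          have hx' : x ∈ half T.graph y' y := by
            refine (mem_half_iff_dist T.isTree hadj.symm).2 ?_
            rwa [SimpleGraph.dist_comm, SimpleGraph.dist_comm (u := x)]
          have hy' : y' ∈ S := by
            refine (T.sideSetoid a b).trans (T.sideSetoid_of_adj hadj.symm fun h => ?_) hy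
            exact notMem_half_of_mem T.isTree hadj.symm ((T.sideSetoid_mem_half hab hy h).2 hx')
          have h1 : (T.graph.induce S).Adj ⟨y, hy⟩ ⟨y', hy'⟩ := hadj
          exact h1.reachable.trans (ih _ (hn ▸ hlt) y' hy' rfl)
      rw [SimpleGraph.connected_iff]
      exact ⟨fun y z => (key _ y y.2 rfl).trans (key _ z z.2 rfl).symm, ⟨⟨x, hxS⟩⟩⟩
  have ha : a ∈ S := huniv ▸ Set.mem_univ a
  have hb : b ∈ S := huniv ▸ Set.mem_univ b
  exact T.not_sideSetoid_of_adj hab hab ⟨1, by simp⟩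
    ((T.sideSetoid a b).trans ha ((T.sideSetoid a b).symm hb))

/-- The graph obtained from `T` by collapsing all edges outside the orbit of `{a, b}`. -/
def sideGraph (T : GTree G) (a b : T.V) : SimpleGraph (Quotient (T.sideSetoid a b)) where
  Adj p q := p ≠ q ∧ ∃ x y, Quotient.mk _ x = p ∧ Quotient.mk _ y = q ∧ T.graph.Adj x y ∧
    s(x, y) ∈ T.edgeOrbit a b
  symm := ⟨fun _ _ ⟨hne, x, y, hx, hy, hxy, hS⟩ =>
    ⟨hne.symm, y, x, hy, hx, hxy.symm, by rwa [Sym2.eq_swap]⟩⟩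
  loopless := ⟨fun _ h => h.1 rfl⟩

theorem sideGraph_adj (T : GTree G) {a b : T.V} (hab : T.graph.Adj a b)
    {p q : Quotient (T.sideSetoid a b)} : (T.sideGraph a b).Adj p q ↔
      ∃ x y, Quotient.mk _ x = p ∧ Quotient.mk _ y = q ∧ T.graph.Adj x y ∧
        s(x, y) ∈ T.edgeOrbit a b := by
  refine ⟨fun h => h.2, fun h => ⟨?_, h⟩⟩
  obtain ⟨x, y, rfl, rfl, hxy, hS⟩ := h
  exact fun heq => T.not_sideSetoid_of_adj hab hxy hS (Quotient.exact heq)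

theorem sideGraph_isTree (T : GTree G) {a b : T.V} (hab : T.graph.Adj a b) :
    (T.sideGraph a b).IsTree := by
  refine ⟨?_, ?_⟩
  · rw [SimpleGraph.connected_iff]
    refine ⟨fun p q => ?_, ⟨Quotient.mk _ a⟩⟩
    obtain ⟨x, rfl⟩ := Quotient.exists_rep p
    obtain ⟨y, rfl⟩ := Quotient.exists_rep q
    obtain ⟨w⟩ := T.isTree.connected.preconnected x y
    induction w with
    | nil => exact SimpleGraph.Reachable.refl _
    | @cons x z y h w ih =>
      by_cases hS : s(x, z) ∈ T.edgeOrbit a b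
      · exact ((T.sideGraph_adj hab).2 ⟨x, z, rfl, rfl, h, hS⟩).reachable.trans ih
      · rwa [Quotient.sound (T.sideSetoid_of_adj h hS)]
  · rw [SimpleGraph.isAcyclic_iff_forall_adj_isBridge]
    intro p q hpq
    obtain ⟨x, y, rfl, rfl, hxy, hS⟩ := (T.sideGraph_adj hab).1 hpq
    rw [SimpleGraph.isBridge_iff]
    have hS' : s(y, x) ∈ T.edgeOrbit a b := by rwa [Sym2.eq_swap]
    have key : ∀ z ∈ half (T.sideGraph a b) (Quotient.mk _ y) (Quotient.mk _ x),
        ∀ w, Quotient.mk _ w = z → w ∈ half T.graph y x := by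
      refine half_induction ?_ ?_
      · intro w hw
        exact (T.sideSetoid_mem_half hab (Quotient.exact hw) hS').2 (left_mem_half y x)
      · intro z z' hzz hne _ ih w hw
        obtain ⟨c, d, rfl, rfl, hcd, hcdS⟩ := (T.sideGraph_adj hab).1 hzz
        rw [T.sideSetoid_mem_half hab (Quotient.exact hw) hS']
        refine mem_half_of_adj hcd (fun heq => hne ?_) (ih d rfl)
        rcases Sym2.eq_iff.1 heq with ⟨rfl, rfl⟩ | ⟨rfl, rfl⟩
        · rfl
        · exact Sym2.eq_swap
    intro hreach
    rw [Sym2.eq_swap] at hreach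
    exact notMem_half_of_mem T.isTree hxy.symm (key _ hreach x rfl)

instance sideAction (T : GTree G) (a b : T.V) : MulAction G (Quotient (T.sideSetoid a b)) where
  smul g := Quotient.map (g • ·) fun _ _ h => T.sideSetoid_smul g h
  one_smul p := by
    obtain ⟨x, rfl⟩ := Quotient.exists_rep p
    exact congrArg _ (one_smul G x)
  mul_smul g h p := by
    obtain ⟨x, rfl⟩ := Quotient.exists_rep p
    exact congrArg _ (mul_smul g h x)

/-- The `G`-tree obtained from `T` by collapsing all edges outside the orbit of `{a, b}`. -/
def sideTree (T : GTree G) {a b : T.V} (hab : T.graph.Adj a b) : GTree G where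
  V := Quotient (T.sideSetoid a b)
  graph := T.sideGraph a b
  isTree := T.sideGraph_isTree hab
  action := T.sideAction a b
  smul_adj := by
    intro g p q hpq
    obtain ⟨x, y, rfl, rfl, hxy, hS⟩ := (T.sideGraph_adj hab).1 hpq
    exact (T.sideGraph_adj hab).2 ⟨g • x, g • y, rfl, rfl, T.smul_adj g _ _ hxy,
      (T.smul_mem_edgeOrbit g).2 hS⟩
  no_inversion := by
    intro g p q hpq ⟨h1, h2⟩
    obtain ⟨x, y, rfl, rfl, hxy, hS⟩ := (T.sideGraph_adj hab).1 hpq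
    have hx : g • x ∉ half T.graph x y := fun h =>
      notMem_half_of_mem T.isTree hxy
        ((T.sideSetoid_mem_half hab (Quotient.exact h1) hS).1 h)
    have hy : g • y ∈ half T.graph x y :=
      (T.sideSetoid_mem_half hab (Quotient.exact h2) hS).2 (left_mem_half x y)
    by_cases heq : s(g • x, g • y) = s(x, y)
    · rw [(T.smul_eq_of_edge_eq hxy heq).1] at hx
      exact hx (left_mem_half x y)
    · exact hx ((mem_half_congr ((T.adj_smul g).2 hxy) heq).2 hy)

/-- The splitting given by the edge `{a, b}` of a minimal `G`-tree: its tree is obtained by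
collapsing all edges that are not translates of `{a, b}`. -/
def edgeSplitting (T : GTree G) (hT : T.IsMinimal) {a b : T.V} (hab : T.graph.Adj a b) :
    Splitting G where
  toGTree := T.sideTree hab
  no_fixed_point := by
    rintro ⟨p, hp⟩
    obtain ⟨x, rfl⟩ := Quotient.exists_rep p
    have h1 : ∀ g : G, g • x ∈ half T.graph a b ↔ x ∈ half T.graph a b := fun g =>
      T.sideSetoid_mem_half hab (Quotient.exact (hp g)) ⟨1, by simp⟩
    obtain ⟨g, hg, -⟩ := hT.isLarge_half hab x x
    obtain ⟨k, hk, -⟩ := hT.isLarge_half hab.symm x x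
    exact notMem_half_swap T.isTree hab ((h1 k).2 ((h1 g).1 hg)) hk
  exists_edge := ⟨Quotient.mk _ a, Quotient.mk _ b,
    (T.sideGraph_adj hab).2 ⟨a, b, rfl, rfl, hab, ⟨1, by simp⟩⟩⟩
  edges_one_orbit := by
    intro p q p' q' hpq hpq'
    obtain ⟨x, y, rfl, rfl, hxy, g, hg⟩ := (T.sideGraph_adj hab).1 hpq
    obtain ⟨x', y', rfl, rfl, hxy', g', hg'⟩ := (T.sideGraph_adj hab).1 hpq'
    refine ⟨g' * g⁻¹, ?_⟩
    have h1 : Sym2.map (fun z => (g' * g⁻¹) • z) s(x, y) = s(x', y') := by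
      rw [hg, hg']
      simp [mul_smul]
    have h2 := congrArg (Sym2.map (Quotient.mk (T.sideSetoid a b))) h1
    exact h2

theorem edgeSplitting_isCollapse (T : GTree G) (hT : T.IsMinimal) {a b : T.V}
    (hab : T.graph.Adj a b) :
    IsCollapse T (T.edgeSplitting hT hab).toGTree (T.edgeOrbit a b)ᶜ
      (Quotient.mk (T.sideSetoid a b)) where
  equivariant _ _ := rfl
  surjective := Quotient.exists_rep
  eq_iff x y := by
    rw [reachable_iff_separating T.isTree]
    constructor
    · intro h c d _ hx hy hS
      exact hy ((T.sideSetoid_mem_half hab (Quotient.exact h) hS).1 hx)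
    · intro H
      refine Quotient.sound fun h => ?_
      have hadj := (T.adj_smul h).2 hab
      constructor
      · intro hx
        by_contra hy
        exact H _ _ hadj hx hy ⟨h, rfl⟩
      · intro hy
        by_contra hx
        exact H _ _ hadj.symm ((mem_half_swap T.isTree hadj).2 hx)
          (notMem_half_swap T.isTree hadj hy) ⟨h, Sym2.eq_swap⟩
  adj_iff p q := by
    refine (T.sideGraph_adj hab).trans ?_
    simp only [Set.mem_compl_iff, not_not]
    rfl

end GTree

/-- An edge that lies outside a half does not separate two vertices of this half. -/
theorem mem_half_congr_of_mem {V : Type*} {Γ : SimpleGraph V} (hΓ : Γ.IsTree) {a b p q x y : V}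
    (hab : Γ.Adj a b) (hpq : Γ.Adj p q) (hne : s(p, q) ≠ s(a, b)) (hp : p ∈ half Γ b a)
    (hx : x ∈ half Γ a b) (hy : y ∈ half Γ a b) : x ∈ half Γ p q ↔ y ∈ half Γ p q := by
  have hne' : s(b, a) ≠ s(p, q) := by rw [Sym2.eq_swap]; exact hne.symm
  have hne2 : s(b, a) ≠ s(q, p) := by rw [Sym2.eq_swap (a := q)]; exact hne'
  have hq : q ∈ half Γ b a :=
    (mem_half_congr hpq (by rw [Sym2.eq_swap (a := b)]; exact hne)).1 hp
  rcases mem_half_or hΓ p q b with hb | hb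
  · have := half_subset_half hΓ hab.symm hne' hp hb
    exact iff_of_true (this hx) (this hy)
  · have := half_subset_half hΓ hab.symm hne2 hq hb
    exact iff_of_false (notMem_half_swap hΓ hpq.symm (this hx))
      (notMem_half_swap hΓ hpq.symm (this hy))

namespace GTree

variable {G : Type u} [Group G]

/-! ### Composing collapses -/

namespace IsCollapse

theorem map_eq_iff_orbit {R A : GTree G} {c d : R.V} {κ : R.V → A.V} (hcd : R.graph.Adj c d)
    (h : IsCollapse R A (R.edgeOrbit c d)ᶜ κ) {x y : R.V} :
    κ x = κ y ↔ ∀ g : G, x ∈ half R.graph (g • c) (g • d) ↔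
      y ∈ half R.graph (g • c) (g • d) := by
  constructor
  · intro hxy g
    exact h.mem_half_congr_of_eq ((R.adj_smul g).2 hcd)
      (fun hc => hc (R.self_mem_edgeOrbit g c d)) hxy
  · intro H
    refine h.map_eq_iff.2 fun p q hpq hx hy hS => hy ?_
    exact (R.sideSetoid_mem_half hcd (x := x) (y := y) H hS).1 hx

theorem comp {R T B : GTree G} {S : Set (Sym2 R.V)} {S' : Set (Sym2 T.V)} {S'' : Set (Sym2 R.V)}
    {π : R.V → T.V} {κ : T.V → B.V} (h : IsCollapse R T S π) (h' : IsCollapse T B S' κ)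
    (hS : ∀ x y, R.graph.Adj x y → (s(x, y) ∉ S'' ↔ s(x, y) ∉ S ∧ s(π x, π y) ∉ S')) :
    IsCollapse R B S'' (κ ∘ π) where
  equivariant g x := by simp [h.equivariant, h'.equivariant]
  surjective := h'.surjective.comp h.surjective
  eq_iff x y := by
    rw [reachable_iff_separating R.isTree, Function.comp_apply, Function.comp_apply,
      h'.map_eq_iff]
    constructor
    · intro H a b hab hx hy
      by_contra hc
      obtain ⟨h1, h2⟩ := (hS a b hab).1 hc
      exact h2 (H _ _ (h.map_adj hab h1) ((h.map_mem_half_iff hab h1).2 hx)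
        fun hh => hy ((h.map_mem_half_iff hab h1).1 hh))
    · intro H c d hcd hx hy
      obtain ⟨a, b, rfl, rfl, hab, h1⟩ := h.exists_lift hcd
      by_contra hc
      exact (hS a b hab).2 ⟨h1, hc⟩ (H a b hab ((h.map_mem_half_iff hab h1).1 hx)
        fun hh => hy ((h.map_mem_half_iff hab h1).2 hh))
  adj_iff p q := by
    rw [h'.adj_iff]
    constructor
    · rintro ⟨c, d, rfl, rfl, hcd, hc⟩
      obtain ⟨a, b, rfl, rfl, hab, h1⟩ := h.exists_lift hcd
      exact ⟨a, b, rfl, rfl, hab, (hS a b hab).2 ⟨h1, hc⟩⟩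
    · rintro ⟨a, b, rfl, rfl, hab, hc⟩
      obtain ⟨h1, h2⟩ := (hS a b hab).1 hc
      exact ⟨π a, π b, rfl, rfl, h.map_adj hab h1, h2⟩

end IsCollapse

/-! ### Edges without anything between them define isomorphic splittings -/

/-- If no translate of the edges `{c, d}` and `{a, b}` lies in the region between these two edges,
then `R` collapses to isomorphic trees along the two orbits of edges.  Indeed, the translates of
the region between the edges are pairwise equal or disjoint, and a vertex in no such translate
lies on the same side of `g {c, d}` and of `g {a, b}`, for all `g`. -/
theorem isomorphic_of_no_edge_between {R A D : GTree G} {c d a b : R.V} {κ₁ : R.V → A.V}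
    {κ₂ : R.V → D.V} (hcd : R.graph.Adj c d) (hab : R.graph.Adj a b)
    (h₁ : IsCollapse R A (R.edgeOrbit c d)ᶜ κ₁) (h₂ : IsCollapse R D (R.edgeOrbit a b)ᶜ κ₂)
    (hdisj : s(a, b) ∉ R.edgeOrbit c d)
    (ha : a ∈ half R.graph c d) (hc : c ∈ half R.graph a b)
    (hM₁ : ∀ g : G, g • c ∈ half R.graph c d ∩ half R.graph a b →
      g • d ∉ half R.graph c d ∩ half R.graph a b)
    (hM₂ : ∀ g : G, g • a ∈ half R.graph c d ∩ half R.graph a b →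
      g • b ∉ half R.graph c d ∩ half R.graph a b) :
    Isomorphic A D := by
  have hR := R.isTree
  set M := half R.graph c d ∩ half R.graph a b with hM
  have hne : ∀ g h : G, s(g • a, g • b) ≠ s(h • c, h • d) := by
    intro g h heq
    exact hdisj ((R.smul_mem_edgeOrbit g).1 ⟨h, heq⟩)
  have hne1 : ∀ g : G, s(g • a, g • b) ≠ s(c, d) := fun g => by simpa using hne g 1
  have hne2 : ∀ g : G, s(g • c, g • d) ≠ s(a, b) := fun g => by simpa using (hne 1 g).symm
  have hne0 : s(a, b) ≠ s(c, d) := by simpa using hne 1 1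
  have hadj₁ : ∀ g : G, R.graph.Adj (g • c) (g • d) := fun g => (R.adj_smul g).2 hcd
  have hadj₂ : ∀ g : G, R.graph.Adj (g • a) (g • b) := fun g => (R.adj_smul g).2 hab
  have hb : b ∈ half R.graph c d := (mem_half_congr hab hne0).1 ha
  have hd : d ∈ half R.graph a b := (mem_half_congr hcd hne0.symm).1 hc
  have haM : a ∈ M := ⟨ha, left_mem_half a b⟩
  have hcM : c ∈ M := ⟨left_mem_half c d, hc⟩
  have hsub : half R.graph d c ⊆ half R.graph a b := half_subset_half hR hcd hne0.symm ha hc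
  -- the vertices outside all translates of the region between the edges
  let Good : R.V → Prop := fun x => ∀ g : G, g • x ∉ M
  have hgood_smul : ∀ (g : G) x, Good x → Good (g • x) := by
    intro g x hx k
    rw [← mul_smul]; exact hx _
  have hgb : Good b := by
    intro g hgM
    by_cases heq : s(g • a, g • b) = s(a, b)
    · rw [(R.smul_eq_of_edge_eq hab heq).2] at hgM
      exact notMem_half_of_mem hR hab hgM.2
    · exact hM₂ g ⟨(mem_half_congr (hadj₂ g) (hne1 g)).2 hgM.1,
        (mem_half_congr (hadj₂ g) heq).2 hgM.2⟩ hgM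
  have hgd : Good d := by
    intro g hgM
    by_cases heq : s(g • c, g • d) = s(c, d)
    · rw [(R.smul_eq_of_edge_eq hcd heq).2] at hgM
      exact notMem_half_of_mem hR hcd hgM.1
    · exact hM₁ g ⟨(mem_half_congr (hadj₁ g) heq).2 hgM.1,
        (mem_half_congr (hadj₁ g) (hne2 g)).2 hgM.2⟩ hgM
  -- for a good vertex, the sides of `g {c, d}` and of `g {a, b}` correspond
  have hside0 : ∀ x, x ∉ M → (x ∈ half R.graph c d ↔ x ∉ half R.graph a b) := by
    intro x hx
    constructor
    · exact fun h1 h2 => hx ⟨h1, h2⟩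
    · intro h2
      by_contra h1
      exact h2 (hsub ((mem_half_swap hR hcd).2 h1))
  have hside : ∀ x, Good x → ∀ g : G, x ∈ half R.graph (g • c) (g • d) ↔
      x ∉ half R.graph (g • a) (g • b) := by
    intro x hx g
    rw [R.mem_half_smul, R.mem_half_smul]
    exact hside0 _ (hx g⁻¹)
  have heq : ∀ x y, Good x → Good y → (κ₁ x = κ₁ y ↔ κ₂ x = κ₂ y) := by
    intro x y hx hy
    rw [h₁.map_eq_iff_orbit hcd, h₂.map_eq_iff_orbit hab]
    refine forall_congr' fun g => ?_
    rw [hside x hx, hside y hy, not_iff_not]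
  have hM1 : ∀ x ∈ M, κ₁ x = κ₁ b := by
    intro x hx
    rw [h₁.map_eq_iff_orbit hcd]
    intro g
    by_cases hg : s(g • c, g • d) = s(c, d)
    · rw [(R.smul_eq_of_edge_eq hcd hg).1, (R.smul_eq_of_edge_eq hcd hg).2]
      exact iff_of_true hx.1 hb
    by_cases h1 : g • c ∈ half R.graph c d
    · have h2 : g • c ∉ half R.graph a b := fun h2 => hM₁ g ⟨h1, h2⟩
        ⟨(mem_half_congr (hadj₁ g) hg).1 h1, (mem_half_congr (hadj₁ g) (hne2 g)).1 h2⟩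
      rw [mem_half_congr_of_mem hR hab (hadj₁ g) (hne2 g) ((mem_half_swap hR hab).2 h2) hx.2
        (left_mem_half a b)]
      exact mem_half_congr hab (hne2 g).symm
    · exact mem_half_congr_of_mem hR hcd (hadj₁ g) hg ((mem_half_swap hR hcd).2 h1) hx.1 hb
  have hM2 : ∀ x ∈ M, κ₂ x = κ₂ d := by
    intro x hx
    rw [h₂.map_eq_iff_orbit hab]
    intro g
    by_cases hg : s(g • a, g • b) = s(a, b)
    · rw [(R.smul_eq_of_edge_eq hab hg).1, (R.smul_eq_of_edge_eq hab hg).2]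
      exact iff_of_true hx.2 hd
    by_cases h1 : g • a ∈ half R.graph a b
    · have h2 : g • a ∉ half R.graph c d := fun h2 => hM₂ g ⟨h2, h1⟩
        ⟨(mem_half_congr (hadj₂ g) (hne1 g)).1 h2, (mem_half_congr (hadj₂ g) hg).1 h1⟩
      rw [mem_half_congr_of_mem hR hcd (hadj₂ g) (hne1 g) ((mem_half_swap hR hcd).2 h2) hx.1
        (left_mem_half c d)]
      exact mem_half_congr hcd (hne1 g).symm
    · exact mem_half_congr_of_mem hR hab (hadj₂ g) hg ((mem_half_swap hR hab).2 h1) hx.2 hd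
  have tot₁ : ∀ p, ∃ x, Good x ∧ κ₁ x = p := by
    intro p
    obtain ⟨x, rfl⟩ := h₁.surjective p
    by_cases hx : Good x
    · exact ⟨x, hx, rfl⟩
    · simp only [Good, not_forall, not_not] at hx
      obtain ⟨g, hg⟩ := hx
      refine ⟨g⁻¹ • b, hgood_smul _ _ hgb, ?_⟩
      rw [h₁.equivariant, ← hM1 _ hg, ← h₁.equivariant, inv_smul_smul]
  have tot₂ : ∀ p, ∃ x, Good x ∧ κ₂ x = p := by
    intro p
    obtain ⟨x, rfl⟩ := h₂.surjective p
    by_cases hx : Good x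
    · exact ⟨x, hx, rfl⟩
    · simp only [Good, not_forall, not_not] at hx
      obtain ⟨g, hg⟩ := hx
      refine ⟨g⁻¹ • d, hgood_smul _ _ hgd, ?_⟩
      rw [h₂.equivariant, ← hM2 _ hg, ← h₂.equivariant, inv_smul_smul]
  choose r₁ hr₁ using tot₁
  choose r₂ hr₂ using tot₂
  have hf : ∀ x, Good x → κ₂ (r₁ (κ₁ x)) = κ₂ x := fun x hx =>
    (heq _ _ (hr₁ _).1 hx).1 (hr₁ _).2
  have hf' : ∀ x, Good x → κ₁ (r₂ (κ₂ x)) = κ₁ x := fun x hx =>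
    (heq _ _ (hr₂ _).1 hx).2 (hr₂ _).2
  let e : A.V ≃ D.V :=
    { toFun := fun p => κ₂ (r₁ p)
      invFun := fun q => κ₁ (r₂ q)
      left_inv := fun p => by
        change κ₁ (r₂ (κ₂ (r₁ p))) = p
        rw [hf' _ (hr₁ p).1, (hr₁ p).2]
      right_inv := fun q => by
        change κ₂ (r₁ (κ₁ (r₂ q))) = q
        rw [hf _ (hr₂ q).1, (hr₂ q).2] }
  have he : ∀ x, Good x → e (κ₁ x) = κ₂ x := hf
  have hec : ∀ g : G, e (κ₁ (g • c)) = κ₂ (g • b) := by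
    intro g
    rw [h₁.equivariant, hM1 c hcM, ← h₁.equivariant, he _ (hgood_smul g _ hgb)]
  have hed : ∀ g : G, e (κ₁ (g • d)) = κ₂ (g • a) := by
    intro g
    rw [he _ (hgood_smul g _ hgd), h₂.equivariant, ← hM2 a haM, ← h₂.equivariant]
  refine ⟨⟨e, ?_⟩, ?_⟩
  · intro p q
    constructor
    · intro hpq
      obtain ⟨x, y, hx, hy, hxy, hS⟩ := h₂.exists_lift hpq
      have hS' : s(x, y) ∈ R.edgeOrbit a b := by simpa using hS
      obtain ⟨g, hg⟩ := hS'
      have hadj : A.graph.Adj (κ₁ (g • c)) (κ₁ (g • d)) :=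
        h₁.map_adj (hadj₁ g) fun hh => hh (R.self_mem_edgeOrbit g c d)
      rcases Sym2.eq_iff.1 hg with ⟨rfl, rfl⟩ | ⟨rfl, rfl⟩
      · have hp : p = κ₁ (g • d) := e.injective (hx.symm.trans (hed g).symm)
        have hq : q = κ₁ (g • c) := e.injective (hy.symm.trans (hec g).symm)
        rw [hp, hq]; exact hadj.symm
      · have hp : p = κ₁ (g • c) := e.injective (hx.symm.trans (hec g).symm)
        have hq : q = κ₁ (g • d) := e.injective (hy.symm.trans (hed g).symm)
        rw [hp, hq]; exact hadj
    · intro hpq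
      obtain ⟨x, y, rfl, rfl, hxy, hS⟩ := h₁.exists_lift hpq
      have hS' : s(x, y) ∈ R.edgeOrbit c d := by simpa using hS
      obtain ⟨g, hg⟩ := hS'
      have hadj : D.graph.Adj (κ₂ (g • a)) (κ₂ (g • b)) :=
        h₂.map_adj (hadj₂ g) fun hh => hh (R.self_mem_edgeOrbit g a b)
      rcases Sym2.eq_iff.1 hg with ⟨rfl, rfl⟩ | ⟨rfl, rfl⟩
      · rw [hec, hed]; exact hadj.symm
      · rw [hec, hed]; exact hadj
  · intro g p
    change e (g • p) = g • e p
    obtain ⟨hgx, hx⟩ := hr₁ p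
    rw [← hx, ← h₁.equivariant, he _ (hgood_smul g _ hgx), he _ hgx, h₂.equivariant]

/-- If the region between two edges of different orbits is not large, although all halves at
translates of these edges are large, then `R` collapses to isomorphic trees along the two orbits:
a translate of one of the edges inside the region separates the two edges, so that the edges can be
replaced by a closer pair until there is no such translate. -/
theorem isomorphic_of_not_isLarge {R A D : GTree G} {κ₁ : R.V → A.V} {κ₂ : R.V → D.V} (n : ℕ) :
    ∀ {c d a b : R.V}, R.graph.Adj c d → R.graph.Adj a b →
    IsCollapse R A (R.edgeOrbit c d)ᶜ κ₁ → IsCollapse R D (R.edgeOrbit a b)ᶜ κ₂ →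
    s(a, b) ∉ R.edgeOrbit c d →
    (∀ x y, R.graph.Adj x y → IsLarge G (half R.graph x y)) →
    a ∈ half R.graph c d → c ∈ half R.graph a b →
    ¬ IsLarge G (half R.graph c d ∩ half R.graph a b) → R.graph.dist c a = n →
    Isomorphic A D := by
  induction n using Nat.strong_induction_on with
  | _ n ih =>
    intro c d a b hcd hab h₁ h₂ hdisj hL ha hc hnL hn
    have hR := R.isTree
    have hne0 : ∀ {p q}, s(p, q) ∈ R.edgeOrbit c d → s(p, q) ≠ s(a, b) := by
      intro p q h heq; exact hdisj (heq ▸ h)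
    have hne1 : ∀ {p q}, s(p, q) ∈ R.edgeOrbit a b → s(p, q) ≠ s(c, d) := by
      intro p q h heq
      have : s(c, d) ∈ R.edgeOrbit a b := heq ▸ h
      apply hdisj
      rw [R.edgeOrbit_eq_of_mem this]
      exact ⟨1, by simp⟩
    have key₁ : ∀ {p q}, R.graph.Adj p q → s(p, q) ∈ R.edgeOrbit c d →
        p ∈ half R.graph c d ∩ half R.graph a b → q ∈ half R.graph c d ∩ half R.graph a b →
        c ∈ half R.graph q p → Isomorphic A D := by
      intro p q hpq hO hp hq hcq
      have hsub : half R.graph p q ⊆ half R.graph c d := by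
        refine half_subset_half hR hpq.symm ?_ hcq hq.1
        intro heq
        rw [Sym2.eq_swap] at heq
        rcases Sym2.eq_iff.1 heq with ⟨-, rfl⟩ | ⟨rfl, -⟩
        · exact notMem_half_of_mem hR hcd hq.1
        · exact notMem_half_of_mem hR hcd hp.1
      have hapq : a ∈ half R.graph p q := by
        by_contra h
        have h' : a ∈ half R.graph q p := (mem_half_swap hR hpq).2 h
        have hsub' : half R.graph p q ⊆ half R.graph a b := by
          refine half_subset_half hR hpq.symm ?_ h' hq.2
          rw [Sym2.eq_swap]; exact hne0 hO
        exact hnL ((hL p q hpq).mono fun z hz => ⟨hsub hz, hsub' hz⟩)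
      have hOeq := R.edgeOrbit_eq_of_mem hO
      refine ih _ ?_ hpq hab (hOeq ▸ h₁) h₂ (hOeq ▸ hdisj) hL hapq hp.2
        (fun h => hnL (h.mono fun z hz => ⟨hsub hz.1, hz.2⟩)) rfl
      rw [← hn]
      exact dist_lt_of_mem_half hR hpq hcq hapq
    have key₂ : ∀ {p q}, R.graph.Adj p q → s(p, q) ∈ R.edgeOrbit a b →
        p ∈ half R.graph c d ∩ half R.graph a b → q ∈ half R.graph c d ∩ half R.graph a b →
        a ∈ half R.graph q p → Isomorphic A D := by
      intro p q hpq hO hp hq haq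
      have hsub : half R.graph p q ⊆ half R.graph a b := by
        refine half_subset_half hR hpq.symm ?_ haq hq.2
        intro heq
        rw [Sym2.eq_swap] at heq
        rcases Sym2.eq_iff.1 heq with ⟨-, rfl⟩ | ⟨rfl, -⟩
        · exact notMem_half_of_mem hR hab hq.2
        · exact notMem_half_of_mem hR hab hp.2
      have hcpq : c ∈ half R.graph p q := by
        by_contra h
        have h' : c ∈ half R.graph q p := (mem_half_swap hR hpq).2 h
        have hsub' : half R.graph p q ⊆ half R.graph c d := by
          refine half_subset_half hR hpq.symm ?_ h' hq.1
          rw [Sym2.eq_swap]; exact hne1 hO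
        exact hnL ((hL p q hpq).mono fun z hz => ⟨hsub' hz, hsub hz⟩)
      have hOeq := R.edgeOrbit_eq_of_mem hO
      refine ih _ ?_ hcd hpq h₁ (hOeq ▸ h₂) ?_ hL hp.1 hcpq
        (fun h => hnL (h.mono fun z hz => ⟨hz.1, hsub hz.2⟩)) rfl
      · rw [← hn, SimpleGraph.dist_comm, SimpleGraph.dist_comm (u := c)]
        exact dist_lt_of_mem_half hR hpq haq hcpq
      · intro h
        apply hdisj
        rw [← R.edgeOrbit_eq_of_mem h, hOeq]
        exact ⟨1, by simp⟩
    by_contra hno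
    refine hno (isomorphic_of_no_edge_between hcd hab h₁ h₂ hdisj ha hc ?_ ?_)
    · intro g hgc hgd
      have hadj := (R.adj_smul g).2 hcd
      rcases mem_half_or hR (g • c) (g • d) c with h | h
      · exact hno (key₁ hadj.symm ⟨g, Sym2.eq_swap⟩ hgd hgc h)
      · exact hno (key₁ hadj ⟨g, rfl⟩ hgc hgd h)
    · intro g hga hgb
      have hadj := (R.adj_smul g).2 hab
      rcases mem_half_or hR (g • a) (g • b) a with h | h
      · exact hno (key₂ hadj.symm ⟨g, Sym2.eq_swap⟩ hgb hga h)
      · exact hno (key₂ hadj ⟨g, rfl⟩ hga hgb h)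

end GTree

/-! ### Enclosures -/

variable {G : Type u} [Group G]

/-- The data witnessing that a vertex orbit of `T` encloses `σ`: a tree `R` with an edge `{a, b}`,
together with collapses onto `T` and onto the tree of `σ`. -/
structure GTree.Enclosure (T : GTree G) (σ : Splitting G) where
  R : GTree G
  a : R.V
  b : R.V
  adj : R.graph.Adj a b
  ρ : R.V → σ.V
  hρ : GTree.IsCollapse R σ.toGTree (R.edgeOrbit a b)ᶜ ρ
  π : R.V → T.V
  hπ : GTree.IsCollapse R T (R.edgeOrbit a b) π

namespace GTree.Enclosure

variable {T : GTree G} {σ : Splitting G}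

/-- The vertex of `T` to which the edge `{a, b}` is collapsed. -/
def vertex (E : Enclosure T σ) : T.V := E.π E.a

/-- The translate of an enclosure: the same refinement of `T`, with a translated edge. -/
def smul (E : Enclosure T σ) (g : G) : Enclosure T σ where
  R := E.R
  a := g • E.a
  b := g • E.b
  adj := (E.R.adj_smul g).2 E.adj
  ρ := E.ρ
  hρ := by rw [E.R.edgeOrbit_smul]; exact E.hρ
  π := E.π
  hπ := by rw [E.R.edgeOrbit_smul]; exact E.hπ

/-- The same enclosure with the edge `{a, b}` reversed. -/
def swap (E : Enclosure T σ) : Enclosure T σ where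
  R := E.R
  a := E.b
  b := E.a
  adj := E.adj.symm
  ρ := E.ρ
  hρ := by rw [E.R.edgeOrbit_swap]; exact E.hρ
  π := E.π
  hπ := by rw [E.R.edgeOrbit_swap]; exact E.hπ

variable (E : Enclosure T σ)

theorem self_mem : s(E.a, E.b) ∈ E.R.edgeOrbit E.a E.b := ⟨1, by simp⟩

theorem π_b : E.π E.b = E.vertex := (E.hπ.map_eq_of_mem E.adj E.self_mem).symm

theorem vertex_swap : E.swap.vertex = E.vertex := E.π_b

theorem vertex_smul (g : G) : (E.smul g).vertex = g • E.vertex := E.hπ.equivariant g _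

theorem ρ_adj : σ.graph.Adj (E.ρ E.a) (E.ρ E.b) :=
  E.hρ.map_adj E.adj fun h => h E.self_mem

theorem ρ_mem_half {z : E.R.V} :
    E.ρ z ∈ half σ.graph (E.ρ E.a) (E.ρ E.b) ↔ z ∈ half E.R.graph E.a E.b :=
  E.hρ.map_mem_half_iff E.adj fun h => h E.self_mem

theorem exists_of_encloses {v : T.V} (h : T.Encloses v σ) {s₁ s₂ : σ.V}
    (hs : σ.graph.Adj s₁ s₂) :
    ∃ E : Enclosure T σ, E.ρ E.a = s₁ ∧ E.ρ E.b = s₂ ∧ ∃ g : G, E.vertex = g • v := by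
  obtain ⟨R, a, b, hab, ⟨ρ, hρ⟩, π, hπ, g, hg⟩ := h
  let E₀ : Enclosure T σ := ⟨R, a, b, hab, ρ, hρ, π, hπ⟩
  obtain ⟨k, hk⟩ := σ.edges_one_orbit _ _ _ _ E₀.ρ_adj hs
  have hv : (E₀.smul k).vertex = (k * g) • v := by
    rw [E₀.vertex_smul, mul_smul]; exact congrArg (k • ·) hg.symm
  rcases Sym2.eq_iff.1 hk with ⟨h1, h2⟩ | ⟨h1, h2⟩
  · exact ⟨E₀.smul k, (E₀.hρ.equivariant k _).trans h1, (E₀.hρ.equivariant k _).trans h2, _, hv⟩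
  · exact ⟨(E₀.smul k).swap, (E₀.hρ.equivariant k _).trans h2,
      (E₀.hρ.equivariant k _).trans h1, _, (E₀.smul k).vertex_swap.trans hv⟩

theorem exists_lift {c d : T.V} (hcd : T.graph.Adj c d) :
    ∃ c' d', E.π c' = c ∧ E.π d' = d ∧ E.R.graph.Adj c' d' ∧
      s(c', d') ∉ E.R.edgeOrbit E.a E.b ∧
      ∀ z, E.π z ∈ half T.graph c d ↔ z ∈ half E.R.graph c' d' := by
  obtain ⟨c', d', rfl, rfl, h, hS⟩ := E.hπ.exists_lift hcd
  exact ⟨c', d', rfl, rfl, h, hS, fun z => E.hπ.map_mem_half_iff h hS⟩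

theorem isLarge_half (hT : T.IsMinimal) {x y : E.R.V} (hxy : E.R.graph.Adj x y) :
    IsLarge G (half E.R.graph x y) := by
  by_cases hS : s(x, y) ∈ E.R.edgeOrbit E.a E.b
  · have hS' : s(x, y) ∉ (E.R.edgeOrbit E.a E.b)ᶜ := fun h => h hS
    exact E.hρ.isLarge_half hxy hS' (σ.isLarge_half (E.hρ.map_adj hxy hS'))
  · exact E.hπ.isLarge_half hxy hS (hT.isLarge_half (E.hπ.map_adj hxy hS))

/-- The refinement of `T` collapses onto the tree of the splitting given by any edge of `T`. -/
theorem isCollapse_edgeSplitting (hT : T.IsMinimal) {c d : T.V} (hcd : T.graph.Adj c d)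
    {c' d' : E.R.V} (hc : E.π c' = c) (hd : E.π d' = d) (hcd' : E.R.graph.Adj c' d')
    (hS : s(c', d') ∉ E.R.edgeOrbit E.a E.b) :
    IsCollapse E.R (T.edgeSplitting hT hcd).toGTree (E.R.edgeOrbit c' d')ᶜ
      (Quotient.mk (T.sideSetoid c d) ∘ E.π) := by
  refine E.hπ.comp (T.edgeSplitting_isCollapse hT hcd) fun x y hxy => ?_
  simp only [Set.mem_compl_iff, not_not]
  subst hc hd
  constructor
  · rintro ⟨g, hg⟩
    refine ⟨?_, g, ?_⟩
    · rw [hg, E.R.smul_mem_edgeOrbit]; exact hS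
    · have := congrArg (Sym2.map E.π) hg
      simpa only [Sym2.map_mk, E.hπ.equivariant] using this
  · rintro ⟨h1, g, hg⟩
    have hS' : s(g • c', g • d') ∉ E.R.edgeOrbit E.a E.b := by
      rwa [E.R.smul_mem_edgeOrbit]
    have hadj := (E.R.adj_smul g).2 hcd'
    refine ⟨g, ?_⟩
    rw [← E.hπ.equivariant, ← E.hπ.equivariant] at hg
    rcases Sym2.eq_iff.1 hg with ⟨h2, h3⟩ | ⟨h2, h3⟩
    · obtain ⟨rfl, rfl⟩ := E.hπ.lift_unique hadj hS' hxy h2 h3; rfl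
    · obtain ⟨rfl, rfl⟩ := E.hπ.lift_unique hadj hS' hxy.symm h3 h2; exact Sym2.eq_swap

theorem notMem_edgeOrbit_symm {c d : E.R.V} (hS : s(c, d) ∉ E.R.edgeOrbit E.a E.b) :
    s(E.a, E.b) ∉ E.R.edgeOrbit c d := by
  intro h
  apply hS
  rw [E.R.edgeOrbit_eq_of_mem h]
  exact ⟨1, by simp⟩

/-- If `σ` is not given by the edge `{c, d}`, and is enclosed on the side of `c`, then that side
meets the side of `E.a` in a large set, and also that of `E.b`, by the same statement for
`E.swap`. -/
theorem isLarge_inter (hT : T.IsMinimal) {c d : T.V} (hcd : T.graph.Adj c d)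
    (hv : E.vertex ∈ half T.graph c d)
    (hiso : ¬ Isomorphic (T.edgeSplitting hT hcd).toGTree σ.toGTree) :
    IsLarge G (E.π ⁻¹' half T.graph c d ∩ half E.R.graph E.a E.b) := by
  have hR := E.R.isTree
  obtain ⟨c', d', hc, hd, hcd', hS, hhalf⟩ := E.exists_lift hcd
  have hpre : E.π ⁻¹' half T.graph c d = half E.R.graph c' d' := Set.ext hhalf
  rw [hpre]
  have ha : E.a ∈ half E.R.graph c' d' := (hhalf _).1 hv
  have hne : s(E.a, E.b) ≠ s(c', d') := fun h => hS (h ▸ E.self_mem)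
  have hb : E.b ∈ half E.R.graph c' d' := (mem_half_congr E.adj hne).1 ha
  rcases mem_half_or hR E.a E.b c' with h | h
  · by_contra hnL
    exact hiso (isomorphic_of_not_isLarge _ hcd' E.adj
      (E.isCollapse_edgeSplitting hT hcd hc hd hcd' hS) E.hρ (E.notMem_edgeOrbit_symm hS)
      (fun x y hxy => E.isLarge_half hT hxy) ha h hnL rfl)
  · have hsub := half_subset_half hR E.adj.symm (by rwa [Sym2.eq_swap]) h hb
    exact (E.isLarge_half hT E.adj).mono fun z hz => ⟨hsub hz, hz⟩

/-- A half of `T` not containing the vertex of the enclosure lies on one side of the edge. -/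
theorem half_subset_or {k₁ k₂ : T.V} (hk : T.graph.Adj k₁ k₂)
    (hv : E.vertex ∈ half T.graph k₁ k₂) :
    (∀ z, E.π z ∈ half T.graph k₂ k₁ → z ∈ half E.R.graph E.a E.b) ∨
      (∀ z, E.π z ∈ half T.graph k₂ k₁ → z ∈ half E.R.graph E.b E.a) := by
  have hR := E.R.isTree
  obtain ⟨c, d, hc, hd, hcd, hS, hhalf⟩ := E.exists_lift hk
  have hhalf' : ∀ z, E.π z ∈ half T.graph k₂ k₁ → z ∈ half E.R.graph d c := by
    intro z hz
    rw [mem_half_swap hR hcd, ← hhalf]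
    exact notMem_half_swap T.isTree hk.symm hz
  have hne : s(E.a, E.b) ≠ s(c, d) := fun h => hS (h ▸ E.self_mem)
  have ha : E.a ∈ half E.R.graph c d := (hhalf _).1 hv
  have hb : E.b ∈ half E.R.graph c d := (mem_half_congr E.adj hne).1 ha
  rcases mem_half_or hR E.a E.b c with h | h
  · exact Or.inl fun z hz => half_subset_half hR hcd hne.symm ha h (hhalf' z hz)
  · exact Or.inr fun z hz => half_subset_half hR hcd
      (by rw [Sym2.eq_swap (a := E.b)]; exact hne.symm) hb h (hhalf' z hz)

end GTree.Enclosure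

/-! ### Edges of a tree do not cross enclosed splittings -/

theorem Splitting.yields_of_isCollapse {R : GTree G} {σ : Splitting G} {a b : R.V} {κ : R.V → σ.V}
    (hab : R.graph.Adj a b) (h : GTree.IsCollapse R σ.toGTree (R.edgeOrbit a b)ᶜ κ) (z : R.V) :
    σ.Yields {g : G | g • z ∈ half R.graph a b} := by
  have hS : s(a, b) ∉ (R.edgeOrbit a b)ᶜ := fun h => h ⟨1, by simp⟩
  refine ⟨κ z, κ a, κ b, h.map_adj hab hS, Set.ext fun g => ?_⟩
  have h1 := mem_half_iff_dist σ.isTree (x := κ (g • z)) (h.map_adj hab hS)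
  rw [h.map_mem_half_iff hab hS, h.equivariant] at h1
  exact h1

theorem cosetFinite_empty (H : Subgroup G) : CosetFinite H (∅ : Set G) :=
  ⟨∅, Set.finite_empty, Set.empty_subset _⟩

namespace GTree

theorem smul_setOf_mem_half (R : GTree G) (a b z : R.V) (g : G) :
    g • {h : G | h • z ∈ half R.graph a b} =
      {h : G | h • z ∈ half R.graph (g • a) (g • b)} := by
  ext h
  rw [Set.mem_smul_set_iff_inv_smul_mem]
  change (g⁻¹ • h) • z ∈ half R.graph a b ↔ h • z ∈ half R.graph (g • a) (g • b)
  rw [R.mem_half_smul, smul_eq_mul, mul_smul]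

theorem compl_setOf_mem_half (R : GTree G) {a b : R.V} (hab : R.graph.Adj a b) (z : R.V) :
    {h : G | h • z ∈ half R.graph a b}ᶜ = {h : G | h • z ∈ half R.graph b a} := by
  ext h
  exact (mem_half_swap R.isTree hab).symm

theorem not_crosses_of_edge_ne (R : GTree G) {a b c d : R.V} (hab : R.graph.Adj a b)
    (hcd : R.graph.Adj c d) (hne : s(c, d) ≠ s(a, b)) (z : R.V) :
    ¬ Crosses {h : G | h • z ∈ half R.graph c d} {h : G | h • z ∈ half R.graph a b} := by
  have hR := R.isTree
  have key : ∀ {X Y : Set G}, (∀ h ∈ X, h ∉ Y) → X ∩ Y = ∅ := fun H =>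
    Set.eq_empty_iff_forall_notMem.2 fun h hh => H h hh.1 hh.2
  have hfin : ∀ {X : Set G} (H : Subgroup G), X = ∅ → CosetFinite H X := fun H hX =>
    hX ▸ cosetFinite_empty H
  rintro ⟨h1, h2, h3, h4⟩
  rw [compl_setOf_mem_half R hab] at h2
  rw [compl_setOf_mem_half R hcd] at h3
  rw [compl_setOf_mem_half R hab, compl_setOf_mem_half R hcd] at h4
  have hne' : s(d, c) ≠ s(a, b) := by rwa [Sym2.eq_swap]
  have hcd' : c ∈ half R.graph a b ↔ d ∈ half R.graph a b := mem_half_congr hcd hne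
  have hcd2 : c ∈ half R.graph b a ↔ d ∈ half R.graph b a :=
    mem_half_congr hcd (by rwa [Sym2.eq_swap (a := b)])
  have hab2 : a ∈ half R.graph d c ↔ b ∈ half R.graph d c := mem_half_congr hab hne'.symm
  have hab' : a ∈ half R.graph c d ↔ b ∈ half R.graph c d := mem_half_congr hab hne.symm
  rcases mem_half_or hR c d a with ha | ha <;> rcases mem_half_or hR a b c with hc | hc
  · exact h4 (hfin _ (key fun h hX => notMem_half_swap hR hab
      (half_subset_half hR hcd hne ha hc hX)))
  · exact h3 (hfin _ (key fun h hX => notMem_half_swap hR hab.symm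
      (half_subset_half hR hcd (by rwa [Sym2.eq_swap (a := b)]) (hab'.1 ha) hc hX)))
  · exact h2 (hfin _ (key fun h hX => notMem_half_swap hR hab
      (half_subset_half hR hcd.symm hne' ha (hcd'.1 hc) hX)))
  · exact h1 (hfin _ (key fun h hX => notMem_half_swap hR hab.symm
      (half_subset_half hR hcd.symm (by rwa [Sym2.eq_swap (a := b)]) (hab2.1 ha)
        (hcd2.1 hc) hX)))

theorem crossingNumber_eq_zero (R : GTree G) {a b c d : R.V} (hab : R.graph.Adj a b)
    (hcd : R.graph.Adj c d) (hS : s(a, b) ∉ R.edgeOrbit c d) (z : R.V) :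
    crossingNumber {h : G | h • z ∈ half R.graph c d} {h : G | h • z ∈ half R.graph a b} = 0 := by
  rw [crossingNumber, Set.encard_eq_zero, Set.eq_empty_iff_forall_notMem]
  rintro D ⟨g, -, hg⟩
  rw [R.smul_setOf_mem_half] at hg
  exact R.not_crosses_of_edge_ne hab ((R.adj_smul g).2 hcd) (fun h => hS ⟨g, h.symm⟩) z hg

theorem exists_translate_subset (R : GTree G) {a b c d : R.V} (hab : R.graph.Adj a b)
    (hcd : R.graph.Adj c d) (hL : IsLarge G (half R.graph c d)) (z : R.V) :
    ∃ A ∈ translates {h : G | h • z ∈ half R.graph a b},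
      A ⊆ {h : G | h • z ∈ half R.graph c d} := by
  have hR := R.isTree
  obtain ⟨g, ha, hb⟩ := hL a b
  have hadj := (R.adj_smul g).2 hab
  have hne : s(g • a, g • b) ≠ s(c, d) := by
    intro heq
    rcases Sym2.eq_iff.1 heq with ⟨-, h⟩ | ⟨h, -⟩
    · exact notMem_half_of_mem hR hcd (h ▸ hb)
    · exact notMem_half_of_mem hR hcd (h ▸ ha)
  rcases mem_half_or hR (g • a) (g • b) c with h | h
  · refine ⟨_, ⟨g, Or.inr rfl⟩, ?_⟩
    rw [R.compl_setOf_mem_half hab, R.smul_setOf_mem_half]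
    exact fun x hx => half_subset_half hR hadj hne h ha hx
  · refine ⟨_, ⟨g, Or.inl rfl⟩, ?_⟩
    rw [R.smul_setOf_mem_half]
    exact fun x hx => half_subset_half hR hadj.symm (by rwa [Sym2.eq_swap]) h hb hx

theorem compl_mem_translates {X A : Set G} (hA : A ∈ translates X) : Aᶜ ∈ translates X := by
  obtain ⟨g, rfl | rfl⟩ := hA
  · exact ⟨g, Or.inr (Set.smul_set_compl).symm⟩
  · exact ⟨g, Or.inl (by rw [Set.smul_set_compl, compl_compl])⟩

theorem almostLE_of_subset {A B : Set G} (h : A ⊆ B) : AlmostLE A B :=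
  Or.inl (by rw [← Set.sdiff_eq, Set.sdiff_eq_empty]; exact h)

/-- The splitting given by an edge of a minimal tree is sandwiched by every splitting enclosed in
the tree, and has intersection number zero with it. -/
theorem edgeSplitting_compatible {T : GTree G} {σ : Splitting G} (E : Enclosure T σ)
    (hT : T.IsMinimal) {c d : T.V} (hcd : T.graph.Adj c d) :
    (T.edgeSplitting hT hcd).SandwichedBy σ ∧
      (T.edgeSplitting hT hcd).IntersectionNumberZero σ := by
  obtain ⟨c', d', hc, hd, hcd', hS, -⟩ := E.exists_lift hcd
  have hY := Splitting.yields_of_isCollapse E.adj E.hρ E.a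
  have hX := Splitting.yields_of_isCollapse hcd'
    (E.isCollapse_edgeSplitting hT hcd hc hd hcd' hS) E.a
  refine ⟨⟨_, _, hX, hY, Or.inl ?_⟩, _, _, hX, hY,
    E.R.crossingNumber_eq_zero E.adj hcd' (E.notMem_edgeOrbit_symm hS) E.a⟩
  obtain ⟨A, hA, hAX⟩ := E.R.exists_translate_subset E.adj hcd' (E.isLarge_half hT hcd') E.a
  obtain ⟨B, hB, hBX⟩ :=
    E.R.exists_translate_subset E.adj hcd'.symm (E.isLarge_half hT hcd'.symm) E.a
  refine ⟨A, hA, Bᶜ, compl_mem_translates hB, almostLE_of_subset hAX, almostLE_of_subset ?_⟩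
  rw [Set.subset_compl_comm, E.R.compl_setOf_mem_half hcd']
  exact hBX

end GTree

theorem Splitting.Yields.of_isomorphic {σ τ : Splitting G}
    (h : GTree.Isomorphic σ.toGTree τ.toGTree) {X : Set G} (hX : σ.Yields X) : τ.Yields X := by
  obtain ⟨φ, hφ⟩ := h
  obtain ⟨v, a, b, hab, rfl⟩ := hX
  refine ⟨φ v, φ a, φ b, φ.map_adj_iff.2 hab, Set.ext fun g => ?_⟩
  have h1 := mem_half_iff_dist σ.isTree (x := g • v) hab
  have h2 := mem_half_iff_dist τ.isTree (x := φ (g • v)) (φ.map_adj_iff.2 hab)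
  rw [mem_half_map_iff φ] at h2
  rw [hφ] at h2
  exact h1.symm.trans h2

/-- A splitting given by an edge of a minimal tree enclosing all splittings of a family can only be
isomorphic to isolated members of this family. -/
theorem Splitting.IsIsolated.of_isomorphic {J : Type w} {σ : J → Splitting G} {T : GTree G}
    (hT : T.IsMinimal) (E : ∀ j, Nonempty (GTree.Enclosure T (σ j))) {c d : T.V}
    (hcd : T.graph.Adj c d) {j : J}
    (h : GTree.Isomorphic (T.edgeSplitting hT hcd).toGTree (σ j).toGTree) :
    Splitting.IsIsolated σ j := by
  intro k _
  obtain ⟨E⟩ := E k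
  obtain ⟨X, Y, hX, hY, h0⟩ := (GTree.edgeSplitting_compatible E hT hcd).2
  exact ⟨X, Y, hX.of_isomorphic h, hY, h0⟩

/-! ### Uniqueness of the place of an enclosed splitting -/

/-- Subsets `U` and `W` of two `G`-sets are jointly large if any point of the first set can be
moved into `U` and any point of the second set into `W` by a single element of `G`. -/
def JointlyLarge (G : Type*) [Group G] {A B : Type*} [MulAction G A] [MulAction G B]
    (U : Set A) (W : Set B) : Prop :=
  ∀ (x : A) (y : B), ∃ g : G, g • x ∈ U ∧ g • y ∈ W

namespace GTree

/-- An element `h` fixing a vertex on each side of an edge fixes this edge: otherwise `h` or its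
inverse moves one of the sides strictly into itself, and its powers eventually move every vertex
there. -/
theorem smul_edge_eq_of_fixed (R : GTree G) {a b x y : R.V} {h : G} (hab : R.graph.Adj a b)
    (hx : x ∈ half R.graph a b) (hy : y ∈ half R.graph b a) (hhx : h • x = x) (hhy : h • y = y) :
    s(h • a, h • b) = s(a, b) := by
  by_contra hne
  have hR := R.isTree
  have hadj := (R.adj_smul h).2 hab
  have hx' : x ∈ half R.graph (h • a) (h • b) := by
    rw [← hhx, R.smul_mem_half_smul]; exact hx
  have hy' : y ∈ half R.graph (h • b) (h • a) := by
    rw [← hhy, R.smul_mem_half_smul]; exact hy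
  have hfix : ∀ (n : ℕ) {z : R.V}, h • z = z → h ^ n • z = z := by
    intro n z hz
    induction n with
    | zero => simp
    | succ n ih => rw [pow_succ, mul_smul, hz, ih]
  have hne' : s(h • b, h • a) ≠ s(a, b) := by rwa [Sym2.eq_swap]
  rcases mem_half_or hR a b (h • a) with h1 | h1 <;>
    rcases mem_half_or hR (h • a) (h • b) a with h2 | h2
  · exact notMem_half_swap hR hab (half_subset_half hR hadj hne h2 h1 hy') hy
  · have hsub : half R.graph (h • a) (h • b) ⊆ half R.graph a b :=
      half_subset_half hR hadj.symm hne' h2 ((mem_half_congr hadj hne).1 h1)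
    obtain ⟨n, hn⟩ := R.exists_pow_smul_mem_half hab hne
      (fun z hz => hsub ((R.smul_mem_half_smul h).2 hz)) y
    rw [hfix n hhy] at hn
    exact notMem_half_swap hR hab hn hy
  · have hne2 : s(h • b, h • a) ≠ s(b, a) := by rwa [Sym2.eq_swap (a := b)]
    have hne3 : s(h • a, h • b) ≠ s(b, a) := by rwa [Sym2.eq_swap (a := b)]
    have hsub : half R.graph (h • b) (h • a) ⊆ half R.graph b a :=
      half_subset_half hR hadj hne3 ((mem_half_congr hab (Ne.symm hne)).1 h2) h1
    obtain ⟨n, hn⟩ := R.exists_pow_smul_mem_half hab.symm hne2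
      (fun z hz => hsub ((R.smul_mem_half_smul h).2 hz)) x
    rw [hfix n hhx] at hn
    exact notMem_half_swap hR hab hx hn
  · have hne3 : s(h • a, h • b) ≠ s(b, a) := by rwa [Sym2.eq_swap (a := b)]
    have hne2 : s(h • b, h • a) ≠ s(b, a) := by rwa [Sym2.eq_swap (a := b)]
    have hb2 : b ∈ half R.graph (h • b) (h • a) := (mem_half_congr hab hne'.symm).1 h2
    exact notMem_half_swap hR hab hx
      (half_subset_half hR hadj.symm hne2 hb2 ((mem_half_congr hadj hne3).1 h1) hx')

/-- A reformulation of being an isolated vertex: there are exactly two neighbours, and the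
stabilizer of the vertex does not interchange them. -/
def HasTwoFixedNeighbors (T : GTree G) (v : T.V) : Prop :=
  ∃ n₁ n₂, (∀ x, T.graph.Adj v x ↔ x = n₁ ∨ x = n₂) ∧ ∀ h : G, h • v = v → h • n₁ ≠ n₂

theorem IsIsolatedVertex.hasTwoFixedNeighbors {T : GTree G} {v : T.V}
    (hv : T.IsIsolatedVertex v) : T.HasTwoFixedNeighbors v := by
  obtain ⟨n₁, n₂, -, hnbr⟩ := Set.encard_eq_two.1 hv.1
  have hnb : ∀ x, T.graph.Adj v x ↔ x = n₁ ∨ x = n₂ := by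
    intro x
    have : x ∈ T.graph.neighborSet v ↔ x ∈ ({n₁, n₂} : Set T.V) := by rw [hnbr]
    simpa using this
  refine ⟨n₁, n₂, hnb, fun h hh hcon => ?_⟩
  have hO : MulAction.orbit (MulAction.stabilizer G v) n₂ =
      MulAction.orbit (MulAction.stabilizer G v) n₁ := by
    rw [MulAction.orbit_eq_iff]
    exact ⟨⟨h, hh⟩, hcon⟩
  have hle : {O : Set T.V | ∃ x, T.graph.Adj v x ∧
      O = MulAction.orbit (MulAction.stabilizer G v) x} ⊆
      {MulAction.orbit (MulAction.stabilizer G v) n₁} := by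
    rintro O ⟨x, hx, rfl⟩
    rcases (hnb x).1 hx with rfl | rfl
    · rfl
    · exact hO
  have := Set.encard_le_encard hle
  rw [hv.2, Set.encard_singleton] at this
  exact absurd this (by norm_num)

theorem HasTwoFixedNeighbors.smul {T : GTree G} {v : T.V} (hv : T.HasTwoFixedNeighbors v)
    (g : G) : T.HasTwoFixedNeighbors (g • v) := by
  obtain ⟨n₁, n₂, hnb, hswap⟩ := hv
  refine ⟨g • n₁, g • n₂, fun x => ?_, fun h hh hcon => ?_⟩
  · have := hnb (g⁻¹ • x)
    rwa [← T.adj_smul g, smul_inv_smul, inv_smul_eq_iff, inv_smul_eq_iff] at this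
  · refine hswap (g⁻¹ * h * g) ?_ ?_
    · rw [mul_smul, mul_smul, hh, inv_smul_smul]
    · rw [mul_smul, mul_smul, hcon, inv_smul_smul]

namespace Enclosure

variable {T : GTree G} {σ : Splitting G} (E : Enclosure T σ)

theorem jointlyLarge {c d : T.V}
    (hL : IsLarge G (E.π ⁻¹' half T.graph c d ∩ half E.R.graph E.a E.b)) :
    JointlyLarge G (half T.graph c d) (half σ.graph (E.ρ E.a) (E.ρ E.b)) := by
  intro x y
  obtain ⟨x', rfl⟩ := E.hπ.surjective x
  obtain ⟨y', rfl⟩ := E.hρ.surjective y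
  obtain ⟨g, hx, hy⟩ := hL x' y'
  refine ⟨g, ?_, ?_⟩
  · rw [← E.hπ.equivariant]; exact hx.1
  · have := E.ρ_mem_half.2 hy.2
    rwa [E.hρ.equivariant] at this

/-- A half of `T` not containing the vertex of the enclosure, or any set controlled by such a half,
cannot be jointly large with both sides of the enclosed edge. -/
theorem not_jointlyLarge {X : Type*} [MulAction G X] {U : Set X} {k₁ k₂ : T.V}
    (hk : T.graph.Adj k₁ k₂) (hv : E.vertex ∈ half T.graph k₁ k₂) (x : X) (t : T.V)
    (hU : ∀ g : G, g • x ∈ U → g • t ∈ half T.graph k₂ k₁) :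
    ¬ (JointlyLarge G U (half σ.graph (E.ρ E.a) (E.ρ E.b)) ∧
      JointlyLarge G U (half σ.graph (E.ρ E.b) (E.ρ E.a))) := by
  rintro ⟨h₁, h₂⟩
  obtain ⟨z, rfl⟩ := E.hπ.surjective t
  rcases E.half_subset_or hk hv with h | h
  · obtain ⟨g, hx, hy⟩ := h₂ x (E.ρ z)
    have := hU g hx
    rw [← E.hπ.equivariant] at this
    have h3 := E.ρ_mem_half.2 (h _ this)
    rw [E.hρ.equivariant] at h3
    exact notMem_half_swap σ.isTree E.ρ_adj h3 hy
  · obtain ⟨g, hx, hy⟩ := h₁ x (E.ρ z)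
    have := hU g hx
    rw [← E.hπ.equivariant] at this
    have h3 := E.swap.ρ_mem_half.2 (h _ this)
    change E.ρ _ ∈ half σ.graph (E.ρ E.b) (E.ρ E.a) at h3
    rw [E.hρ.equivariant] at h3
    exact notMem_half_swap σ.isTree E.ρ_adj hy h3

/-- A splitting that is not given by an edge of `T` is enclosed in only one place. -/
theorem vertex_eq_of_edge_eq (hT : T.IsMinimal)
    (hiso : ∀ {c d : T.V} (hcd : T.graph.Adj c d),
      ¬ Isomorphic (T.edgeSplitting hT hcd).toGTree σ.toGTree)
    (E₁ E₂ : Enclosure T σ) (ha : E₂.ρ E₂.a = E₁.ρ E₁.a) (hb : E₂.ρ E₂.b = E₁.ρ E₁.b) :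
    E₁.vertex = E₂.vertex := by
  by_contra hne
  obtain ⟨x, hx, hv⟩ := exists_adj_mem_half T.isTree hne
  refine E₂.not_jointlyLarge (U := half T.graph E₁.vertex x) hx.symm hv x x
    (fun g h => h) ⟨?_, ?_⟩
  · rw [ha, hb]
    exact E₁.jointlyLarge (E₁.isLarge_inter hT hx (left_mem_half _ _) (hiso hx))
  · rw [ha, hb]
    refine E₁.swap.jointlyLarge (E₁.swap.isLarge_inter hT hx ?_ (hiso hx))
    rw [E₁.vertex_swap]
    exact left_mem_half _ _

/-! ### Isolated vertices -/

theorem eq_a_of_fixed {x y : E.R.V} (hx : x ∈ half E.R.graph E.a E.b)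
    (hy : y ∈ half E.R.graph E.b E.a)
    (hfix : ∀ h : G, h • E.vertex = E.vertex → h • x = x ∧ h • y = y) {z : E.R.V}
    (hz : E.π z = E.vertex) (hza : z ∈ half E.R.graph E.a E.b) : z = E.a := by
  by_contra hne
  obtain ⟨a', hadj, hza'⟩ := exists_adj_mem_half E.R.isTree (Ne.symm hne)
  have hO : s(E.a, a') ∈ E.R.edgeOrbit E.a E.b :=
    E.hπ.map_eq_iff.1 hz.symm _ _ hadj (left_mem_half _ _)
      (notMem_half_swap E.R.isTree hadj.symm hza')
  have hπa' : E.π a' = E.vertex := (E.hπ.map_eq_of_mem hadj hO).symm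
  obtain ⟨h, hh⟩ := hO
  have hv : h • E.vertex = E.vertex := by
    rw [vertex, ← E.hπ.equivariant]
    rcases Sym2.eq_iff.1 hh with ⟨h1, -⟩ | ⟨-, h1⟩
    · rw [← h1]
    · rw [← h1]; exact hπa'
  obtain ⟨h1, h2⟩ := hfix h hv
  have h3 := E.R.smul_edge_eq_of_fixed E.adj hx hy h1 h2
  rw [← hh] at h3
  rcases Sym2.eq_iff.1 h3 with ⟨-, rfl⟩ | ⟨h4, -⟩
  · exact notMem_half_swap E.R.isTree E.adj hza hza'
  · exact E.adj.ne h4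

theorem isomorphic_of_isolated (hT : T.IsMinimal) {n₁ n₂ : T.V}
    (hn₁ : T.graph.Adj n₁ E.vertex)
    (hcover : ∀ v : T.V, v ∈ half T.graph n₁ E.vertex ∨ v = E.vertex ∨
      v ∈ half T.graph n₂ E.vertex)
    (h₂ : ∀ z, E.π z ∈ half T.graph n₂ E.vertex → z ∈ half E.R.graph E.b E.a)
    {x y : E.R.V} (hx : E.π x = E.vertex) (hy : E.π y = n₁) (hxy : E.R.graph.Adj y x)
    (hS : s(y, x) ∉ E.R.edgeOrbit E.a E.b)
    (hxa : x ∈ half E.R.graph E.a E.b)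
    (hpre : ∀ z, E.π z = E.vertex → z ∈ half E.R.graph E.a E.b → z = E.a) :
    Isomorphic (T.edgeSplitting hT hn₁).toGTree σ.toGTree := by
  have hcol := E.isCollapse_edgeSplitting hT hn₁ hy hx hxy hS
  rw [← E.R.edgeOrbit_swap] at hcol
  have hhalf : ∀ z, E.π z ∈ half T.graph E.vertex n₁ ↔ z ∈ half E.R.graph x y := by
    intro z
    rw [← hx, ← hy]
    exact E.hπ.map_mem_half_iff hxy.symm (by rwa [Sym2.eq_swap])
  have hM : ∀ z ∈ half E.R.graph x y ∩ half E.R.graph E.a E.b, z = E.a := by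
    rintro z ⟨h1, h3⟩
    refine hpre z ?_ h3
    rcases hcover (E.π z) with h | h | h
    · exact absurd h (notMem_half_swap T.isTree hn₁.symm ((hhalf z).2 h1))
    · exact h
    · exact absurd (h₂ z h) (notMem_half_swap E.R.isTree E.adj h3)
  refine isomorphic_of_no_edge_between hxy.symm E.adj hcol E.hρ ?_
    ((hhalf _).1 (left_mem_half _ _)) hxa ?_ ?_
  · exact E.notMem_edgeOrbit_symm (by rwa [Sym2.eq_swap])
  · intro g h1 h2
    exact ((E.R.adj_smul g).2 hxy).ne ((hM _ h2).trans (hM _ h1).symm)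
  · intro g h1 h2
    exact ((E.R.adj_smul g).2 E.adj).ne ((hM _ h1).trans (hM _ h2).symm)

/-- The structure of an enclosure at an isolated vertex `w`: the preimage of `w` consists of the two
ends of the enclosed edge, and the two edges at `w`, one on either side of it, give splittings
isomorphic to the enclosed one. -/
structure IsolatedSides (hT : T.IsMinimal) (E : Enclosure T σ) (na nb : T.V) : Prop where
  adj_a : T.graph.Adj na E.vertex
  adj_b : T.graph.Adj nb E.vertex
  side_a : ∀ z, E.π z ∈ half T.graph na E.vertex → z ∈ half E.R.graph E.a E.b
  side_b : ∀ z, E.π z ∈ half T.graph nb E.vertex → z ∈ half E.R.graph E.b E.a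
  cover : ∀ v : T.V, v ∈ half T.graph na E.vertex ∨ v = E.vertex ∨ v ∈ half T.graph nb E.vertex
  preimage : ∀ z, E.π z = E.vertex → z = E.a ∨ z = E.b
  iso_a : Isomorphic (T.edgeSplitting hT adj_a).toGTree σ.toGTree
  iso_b : Isomorphic (T.edgeSplitting hT adj_b).toGTree σ.toGTree

theorem exists_isolatedSides (hT : T.IsMinimal) (hiso : T.HasTwoFixedNeighbors E.vertex)
    (horb : ∀ x, T.graph.Adj x E.vertex → ∀ g : G, g • x ≠ E.vertex) :
    ∃ na nb, IsolatedSides hT E na nb := by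
  have hR := E.R.isTree
  obtain ⟨n₁, n₂, hnb', hswap⟩ := hiso
  have hn₁ : T.graph.Adj n₁ E.vertex := ((hnb' n₁).2 (Or.inl rfl)).symm
  have hn₂ : T.graph.Adj n₂ E.vertex := ((hnb' n₂).2 (Or.inr rfl)).symm
  have hnb : ∀ x, T.graph.Adj E.vertex x → x = n₁ ∨ x = n₂ := fun x => (hnb' x).1
  have hfixn₁ : ∀ h : G, h • E.vertex = E.vertex → h • n₁ = n₁ := by
    intro h hh
    refine (hnb _ ?_).resolve_right (hswap h hh)
    rw [← hh]; exact (T.adj_smul h).2 hn₁.symm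
  have hfixn₂ : ∀ h : G, h • E.vertex = E.vertex → h • n₂ = n₂ := by
    intro h hh
    refine (hnb _ ?_).resolve_left fun hc => ?_
    · rw [← hh]; exact (T.adj_smul h).2 hn₂.symm
    · refine hswap h⁻¹ ?_ ?_
      · rw [inv_smul_eq_iff, hh]
      · rw [inv_smul_eq_iff, hc]
  have hcover : ∀ v : T.V, v ∈ half T.graph n₁ E.vertex ∨ v = E.vertex ∨
      v ∈ half T.graph n₂ E.vertex := by
    intro v
    by_cases hv : E.vertex = v
    · exact Or.inr (Or.inl hv.symm)
    · obtain ⟨x, hx, hvx⟩ := exists_adj_mem_half T.isTree hv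
      rcases hnb x hx with rfl | rfl
      · exact Or.inl hvx
      · exact Or.inr (Or.inr hvx)
  obtain ⟨y₁, x₁, hy₁, hx₁, hxy₁, hS₁, hhalf₁⟩ := E.exists_lift hn₁
  obtain ⟨y₂, x₂, hy₂, hx₂, hxy₂, hS₂, hhalf₂⟩ := E.exists_lift hn₂
  have hfix₁ : ∀ h : G, h • E.vertex = E.vertex → h • x₁ = x₁ := by
    intro h hh
    refine (E.hπ.lift_unique hxy₁ hS₁ ((E.R.adj_smul h).2 hxy₁) ?_ ?_).2
    · rw [E.hπ.equivariant, hy₁, hfixn₁ h hh]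
    · rw [E.hπ.equivariant, hx₁, hh]
  have hfix₂ : ∀ h : G, h • E.vertex = E.vertex → h • x₂ = x₂ := by
    intro h hh
    refine (E.hπ.lift_unique hxy₂ hS₂ ((E.R.adj_smul h).2 hxy₂) ?_ ?_).2
    · rw [E.hπ.equivariant, hy₂, hfixn₂ h hh]
    · rw [E.hπ.equivariant, hx₂, hh]
  -- the half of `T` beyond an edge at the vertex lies on the side where this edge is attached
  have hsideA : ∀ {n : T.V} {x y : E.R.V}, E.R.graph.Adj y x →
      s(y, x) ∉ E.R.edgeOrbit E.a E.b →
      (∀ z, E.π z ∈ half T.graph n E.vertex ↔ z ∈ half E.R.graph y x) →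
      T.graph.Adj n E.vertex →
      (x ∈ half E.R.graph E.a E.b → ∀ z, E.π z ∈ half T.graph n E.vertex →
        z ∈ half E.R.graph E.a E.b) ∧
      (x ∈ half E.R.graph E.b E.a → ∀ z, E.π z ∈ half T.graph n E.vertex →
        z ∈ half E.R.graph E.b E.a) := by
    intro n x y hxy hS hh hadj
    have hne : s(x, y) ≠ s(E.a, E.b) := fun h => hS (by rw [Sym2.eq_swap, h]; exact E.self_mem)
    have ha : E.a ∈ half E.R.graph x y := by
      rw [mem_half_swap hR hxy, ← hh]
      exact notMem_half_swap T.isTree hadj.symm (left_mem_half _ _)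
    have hb : E.b ∈ half E.R.graph x y := (mem_half_congr E.adj hne.symm).1 ha
    exact ⟨fun hx z hz => half_subset_half hR hxy.symm hne ha hx ((hh z).1 hz),
      fun hx z hz => half_subset_half hR hxy.symm (by rwa [Sym2.eq_swap (a := E.b)]) hb hx
        ((hh z).1 hz)⟩
  -- a side of the enclosed edge is not contained in the preimage of the vertex
  have hout : ∀ {p q : E.R.V}, E.R.graph.Adj p q →
      ¬ ∀ z ∈ half E.R.graph p q, E.π z = E.vertex := by
    intro p q hpq H
    obtain ⟨g, hg, -⟩ := E.isLarge_half hT hpq y₁ y₁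
    have := H _ hg
    rw [E.hπ.equivariant, hy₁] at this
    exact horb n₁ hn₁ g this
  have h1 := hsideA hxy₁ hS₁ hhalf₁ hn₁
  have h2 := hsideA hxy₂ hS₂ hhalf₂ hn₂
  have main : ∀ {n₁ n₂ : T.V} {x₁ y₁ x₂ y₂ : E.R.V} (hn₁ : T.graph.Adj n₁ E.vertex)
      (hn₂ : T.graph.Adj n₂ E.vertex),
      (∀ v : T.V, v ∈ half T.graph n₁ E.vertex ∨ v = E.vertex ∨
        v ∈ half T.graph n₂ E.vertex) →
      E.R.graph.Adj y₁ x₁ → E.R.graph.Adj y₂ x₂ →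
      s(y₁, x₁) ∉ E.R.edgeOrbit E.a E.b → s(y₂, x₂) ∉ E.R.edgeOrbit E.a E.b →
      E.π x₁ = E.vertex → E.π x₂ = E.vertex → E.π y₁ = n₁ → E.π y₂ = n₂ →
      (∀ h : G, h • E.vertex = E.vertex → h • x₁ = x₁) →
      (∀ h : G, h • E.vertex = E.vertex → h • x₂ = x₂) →
      x₁ ∈ half E.R.graph E.a E.b → x₂ ∈ half E.R.graph E.b E.a →
      (∀ z, E.π z ∈ half T.graph n₁ E.vertex → z ∈ half E.R.graph E.a E.b) →
      (∀ z, E.π z ∈ half T.graph n₂ E.vertex → z ∈ half E.R.graph E.b E.a) →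
      IsolatedSides hT E n₁ n₂ := by
    intro n₁ n₂ x₁ y₁ x₂ y₂ hn₁ hn₂ hcover hxy₁ hxy₂ hS₁ hS₂ hx₁ hx₂ hy₁ hy₂ hfix₁ hfix₂ ha hb
      hsa hsb
    have hpa : ∀ z, E.π z = E.vertex → z ∈ half E.R.graph E.a E.b → z = E.a := fun z hz hza =>
      E.eq_a_of_fixed ha hb (fun h hh => ⟨hfix₁ h hh, hfix₂ h hh⟩) hz hza
    have hpb : ∀ z, E.π z = E.vertex → z ∈ half E.R.graph E.b E.a → z = E.b := fun z hz hzb =>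
      E.swap.eq_a_of_fixed hb ha
        (fun h hh => by rw [E.vertex_swap] at hh; exact ⟨hfix₂ h hh, hfix₁ h hh⟩)
        (by rw [E.vertex_swap]; exact hz) hzb
    refine ⟨hn₁, hn₂, hsa, hsb, hcover, ?_, ?_, ?_⟩
    · intro z hz
      exact (mem_half_or hR E.a E.b z).imp (hpa z hz) (hpb z hz)
    · exact E.isomorphic_of_isolated hT hn₁ hcover hsb hx₁ hy₁ hxy₁ hS₁ ha hpa
    · have hv : E.swap.vertex = E.vertex := E.vertex_swap
      have key : ∀ (v : T.V) (hv : E.swap.vertex = v) (hn : T.graph.Adj n₂ v),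
          (∀ u : T.V, u ∈ half T.graph n₁ v ∨ u = v ∨ u ∈ half T.graph n₂ v) →
          (∀ z, E.π z ∈ half T.graph n₁ v → z ∈ half E.R.graph E.a E.b) →
          E.π x₂ = v → (∀ z, E.π z = v → z ∈ half E.R.graph E.b E.a → z = E.b) →
          Isomorphic (T.edgeSplitting hT hn).toGTree σ.toGTree := by
        rintro v rfl hn hcov hsa hx₂ hpb
        refine E.swap.isomorphic_of_isolated hT (n₂ := n₁) hn (fun v => ?_) hsa hx₂ hy₂ hxy₂ ?_
          hb hpb
        · rcases hcov v with h | h | h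
          · exact Or.inr (Or.inr h)
          · exact Or.inr (Or.inl h)
          · exact Or.inl h
        · change _ ∉ E.R.edgeOrbit E.b E.a
          rw [E.R.edgeOrbit_swap]; exact hS₂
      exact key _ hv hn₂ hcover hsa hx₂ hpb
  rcases mem_half_or hR E.a E.b x₁ with ha₁ | hb₁ <;>
    rcases mem_half_or hR E.a E.b x₂ with ha₂ | hb₂
  · refine absurd (fun z hz => ?_) (hout E.adj.symm)
    rcases hcover (E.π z) with h | h | h
    · exact absurd hz (notMem_half_swap hR E.adj (h1.1 ha₁ z h))
    · exact h
    · exact absurd hz (notMem_half_swap hR E.adj (h2.1 ha₂ z h))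
  · exact ⟨n₁, n₂, main hn₁ hn₂ hcover hxy₁ hxy₂ hS₁ hS₂ hx₁ hx₂ hy₁ hy₂ hfix₁ hfix₂ ha₁ hb₂
      (h1.1 ha₁) (h2.2 hb₂)⟩
  · refine ⟨n₂, n₁, main hn₂ hn₁ (fun v => ?_) hxy₂ hxy₁ hS₂ hS₁ hx₂ hx₁ hy₂ hy₁ hfix₂ hfix₁ ha₂
      hb₁ (h2.1 ha₂) (h1.2 hb₁)⟩
    rcases hcover v with h | h | h
    · exact Or.inr (Or.inr h)
    · exact Or.inr (Or.inl h)
    · exact Or.inl h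
  · refine absurd (fun z hz => ?_) (hout E.adj)
    rcases hcover (E.π z) with h | h | h
    · exact absurd hz (notMem_half_swap hR E.adj.symm (h1.2 hb₁ z h))
    · exact h
    · exact absurd hz (notMem_half_swap hR E.adj.symm (h2.2 hb₂ z h))

end Enclosure

end GTree

/-! ### Betweenness in trees -/

/-- In a tree, `w` lies between `x` and `y`: it is contained in every half containing both. -/
def Between {V : Type*} (Γ : SimpleGraph V) (x w y : V) : Prop :=
  ∀ a b, Γ.Adj a b → x ∈ half Γ a b → y ∈ half Γ a b → w ∈ half Γ a b

section Between

variable {V : Type*} {Γ : SimpleGraph V}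

theorem Between.symm {x w y : V} (h : Between Γ x w y) : Between Γ y w x :=
  fun a b hab hy hx => h a b hab hx hy

theorem between_left (x y : V) : Between Γ x x y := fun _ _ _ hx _ => hx

theorem between_right (x y : V) : Between Γ x y y := fun _ _ _ _ hy => hy

theorem half_subset_of_notMem (hΓ : Γ.IsTree) {p q w n : V} (hpq : Γ.Adj p q) (hwn : Γ.Adj w n)
    (hw : w ∉ half Γ p q) (hp : p ∈ half Γ w n) : half Γ p q ⊆ half Γ w n := by
  have hne : s(p, q) ≠ s(w, n) := by
    intro h
    rcases Sym2.eq_iff.1 h with ⟨rfl, -⟩ | ⟨rfl, -⟩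
    · exact hw (left_mem_half _ _)
    · exact notMem_half_of_mem hΓ hwn hp
  exact half_subset_half hΓ hpq.symm (by rwa [Sym2.eq_swap]) ((mem_half_swap hΓ hpq).2 hw)
    ((mem_half_congr hpq hne).1 hp)

theorem between_of_mem_half (hΓ : Γ.IsTree) {x w y m n : V} (hn : Γ.Adj n w) (hm : Γ.Adj m w)
    (hnm : n ≠ m) (hx : x ∈ half Γ n w) (hy : y ∈ half Γ m w) : Between Γ x w y := by
  intro p q hpq hxp hyp
  by_contra hw
  rcases mem_half_or hΓ w n p with hp | hp
  · exact notMem_half_swap hΓ hn hx (half_subset_of_notMem hΓ hpq hn.symm hw hp hxp)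
  · have hp' : p ∈ half Γ w m := by
      refine half_subset_half hΓ hn.symm ?_ (left_mem_half _ _) (left_mem_half _ _) hp
      intro h
      rcases Sym2.eq_iff.1 h with ⟨-, h⟩ | ⟨-, rfl⟩
      · exact hnm h
      · exact hn.ne rfl
    exact notMem_half_swap hΓ hm hy (half_subset_of_notMem hΓ hpq hm.symm hw hp' hyp)

/-- If three of the four corners of two halves are nonempty, the remaining one is empty. -/
theorem half_subset_of_corners (hΓ : Γ.IsTree) {p q u v x y z : V} (hpq : Γ.Adj p q)
    (huv : Γ.Adj u v) (hx : x ∈ half Γ p q) (hx' : x ∈ half Γ u v) (hy : y ∈ half Γ p q)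
    (hy' : y ∉ half Γ u v) (hz : z ∉ half Γ p q) (hz' : z ∈ half Γ u v) :
    half Γ q p ⊆ half Γ u v := by
  have hne : s(p, q) ≠ s(u, v) := by
    intro h
    rcases half_eq_of_edge_eq (Γ := Γ) h with h' | h'
    · exact hy' (h' ▸ hy)
    · exact notMem_half_swap hΓ huv hx' (h' ▸ hx)
  have hne1 : s(q, p) ≠ s(u, v) := by rwa [Sym2.eq_swap]
  have hne2 : s(p, q) ≠ s(v, u) := by rwa [Sym2.eq_swap (a := v)]
  have hne3 : s(q, p) ≠ s(v, u) := by rwa [Sym2.eq_swap (a := v)]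
  rcases mem_half_or hΓ u v p with hp | hp <;> rcases mem_half_or hΓ p q u with hu | hu
  · exact half_subset_half hΓ hpq hne hu hp
  · exact absurd (half_subset_half hΓ hpq.symm hne1 hu ((mem_half_congr hpq hne).1 hp) hy) hy'
  · exact absurd (half_subset_half hΓ hpq hne2 ((mem_half_congr huv hne.symm).1 hu) hp
      ((mem_half_swap hΓ hpq).2 hz)) (notMem_half_swap hΓ huv hz')
  · exact absurd (half_subset_half hΓ hpq.symm hne3 ((mem_half_congr huv hne1.symm).1 hu)
      ((mem_half_congr hpq hne2).1 hp) hx) (notMem_half_swap hΓ huv hx')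

theorem eq_of_two_common_neighbors (hΓ : Γ.IsTree)
    {x y a b : V} (hxa : Γ.Adj x a) (hxb : Γ.Adj x b) (hya : Γ.Adj y a) (hyb : Γ.Adj y b)
    (hab : a ≠ b) : x = y := by
  by_contra hxy
  have h1 : y ∈ half Γ a x := by
    refine mem_half_of_adj hya ?_ (left_mem_half _ _)
    intro h
    rcases Sym2.eq_iff.1 h with ⟨rfl, -⟩ | ⟨rfl, -⟩
    · exact hya.ne rfl
    · exact hxy rfl
  have h2 : b ∈ half Γ a x := by
    refine mem_half_of_adj hyb.symm ?_ h1
    intro h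
    rcases Sym2.eq_iff.1 h with ⟨rfl, -⟩ | ⟨rfl, -⟩
    · exact hab rfl
    · exact hxb.ne rfl
  have h3 : x ∈ half Γ a x := by
    refine mem_half_of_adj hxb ?_ h2
    intro h
    rcases Sym2.eq_iff.1 h with ⟨h, -⟩ | ⟨-, h⟩
    · exact hxa.ne h
    · exact hab h.symm
  exact notMem_half_of_mem hΓ hxa.symm h3

theorem between_of_adj (hΓ : Γ.IsTree) {x a m y : V}
    (hxa : Γ.Adj x a) (hxm : Γ.Adj x m) (ham : a ≠ m) (hy : y ∈ half Γ m x) (hym : y ≠ m) :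
    Between Γ a m y := by
  obtain ⟨n, hn, hyn⟩ := exists_adj_mem_half hΓ hym.symm
  refine between_of_mem_half hΓ hxm hn.symm ?_ ?_ hyn
  · rintro rfl
    exact notMem_half_swap hΓ hn hy hyn
  · refine mem_half_of_adj hxa.symm ?_ (left_mem_half _ _)
    intro h
    rcases Sym2.eq_iff.1 h with ⟨rfl, -⟩ | ⟨h, -⟩
    · exact hxa.ne rfl
    · exact ham h

theorem eq_or_eq_of_between (hΓ : Γ.IsTree) {x a b m : V}
    (hxa : Γ.Adj x a) (hxb : Γ.Adj x b) (hmx : m ≠ x) (h : Between Γ a m b) : m = a ∨ m = b := by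
  by_contra! hne
  obtain ⟨n, hn, hxn⟩ := exists_adj_mem_half hΓ hmx
  have key : ∀ c, Γ.Adj x c → m ≠ c → c ∈ half Γ n m := by
    intro c hxc hmc
    refine mem_half_of_adj hxc.symm ?_ hxn
    intro h
    rcases Sym2.eq_iff.1 h with ⟨-, h⟩ | ⟨h, -⟩
    · exact hmx h.symm
    · exact hmc h.symm
  exact notMem_half_of_mem hΓ hn.symm (h n m hn.symm (key a hxa hne.1) (key b hxb hne.2))

theorem eq_of_between_self (hΓ : Γ.IsTree) {x w : V}
    (h : Between Γ x w x) : w = x := by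
  by_contra hne
  obtain ⟨n, hn, hx⟩ := exists_adj_mem_half hΓ hne
  exact notMem_half_of_mem hΓ hn.symm (h n w hn.symm hx hx)

/-- If a vertex `v ≠ y` lies between `y` and each of `x` and `z`, then the first edge from `v`
towards `y` separates `y` from both `x` and `z`. -/
theorem not_between_of_between (hΓ : Γ.IsTree) {x y z v : V}
    (hne : v ≠ y) (hx : Between Γ y v x) (hz : Between Γ y v z) : ¬ Between Γ x y z := by
  obtain ⟨n, hn, hy⟩ := exists_adj_mem_half hΓ hne
  have hv := notMem_half_of_mem hΓ hn.symm
  intro h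
  refine notMem_half_swap hΓ hn.symm hy (h v n hn ?_ ?_)
  · exact (mem_half_swap hΓ hn.symm).2 fun hxn => hv (hx n v hn.symm hy hxn)
  · exact (mem_half_swap hΓ hn.symm).2 fun hzn => hv (hz n v hn.symm hy hzn)

end Between


namespace GTree.Enclosure

/-! ### Edges inserted at vertices of one color -/

variable {T : GTree G} {τ : Splitting G}

/-- If the edge `{a, b}` is inserted away from the orbit of `v`, and `v` lies on the side of `b`,
then an edge of `T` at `v` separates `v` from everything on the side of `a`. -/
theorem exists_adj_of_mem_half (F : Enclosure T τ) {v : F.R.V}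
    (hv : ∀ g : G, g • F.vertex ≠ F.π v) (hvb : v ∈ half F.R.graph F.b F.a) :
    ∃ k, T.graph.Adj (F.π v) k ∧
      ∀ z ∈ half F.R.graph F.a F.b, F.π z ∈ half T.graph k (F.π v) := by
  have hR := F.R.isTree
  have hne : F.π v ≠ F.vertex := fun h => hv 1 (by rw [one_smul, h])
  obtain ⟨k, hk, hvk⟩ := exists_adj_mem_half T.isTree hne
  obtain ⟨k', v', hk', hv', hadj, hS, hhalf⟩ := F.exists_lift hk.symm
  -- the preimage of the vertex is a single vertex
  have hvv : v' = v := by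
    by_contra hne
    obtain ⟨x, hx, hvx⟩ := exists_adj_mem_half hR hne
    obtain ⟨g, hg⟩ : s(v', x) ∈ F.R.edgeOrbit F.a F.b :=
      F.hπ.map_eq_iff.1 hv' _ _ hx (left_mem_half _ _) (notMem_half_swap hR hx.symm hvx)
    apply hv g
    rw [← hv']
    rcases Sym2.eq_iff.1 hg with ⟨h, -⟩ | ⟨h, -⟩
    · rw [h, F.hπ.equivariant]; rfl
    · rw [h, F.hπ.equivariant, F.π_b]
  subst hvv
  refine ⟨k, hk, fun z hz => (hhalf z).2 ?_⟩
  have hne : s(F.a, F.b) ≠ s(k', v') := fun h => hS (h ▸ F.self_mem)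
  have hne' : s(k', v') ≠ s(F.b, F.a) := by rw [Sym2.eq_swap (a := F.b)]; exact hne.symm
  refine half_subset_half hR F.adj.symm (by rwa [Sym2.eq_swap])
    ((mem_half_congr hadj hne').2 hvb) ?_ hz
  exact (mem_half_congr F.adj hne).1 ((hhalf _).1 hvk)

/-- If one side `U` of an edge of `T'` is jointly large with both sides of an edge of `σ`, and the
edge of `T'` is inserted in `T` away from the place `v` where the edge of `σ` is enclosed, then `v`
lies on the side `U` of the inserted edge. -/
theorem mem_half_of_jointlyLarge {T' : GTree G} {σ : Splitting G} (hT' : T'.IsMinimal)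
    {c d c₀ d₀ : T'.V} (hcd : T'.graph.Adj c d) (hcd₀ : T'.graph.Adj c₀ d₀)
    (hO : s(c, d) ∈ T'.edgeOrbit c₀ d₀)
    (F : Enclosure T (T'.edgeSplitting hT' hcd₀))
    (hFa : F.ρ F.a = Quotient.mk (T'.sideSetoid c₀ d₀) c)
    (hFb : F.ρ F.b = Quotient.mk (T'.sideSetoid c₀ d₀) d)
    (E : Enclosure T σ)
    (h₁ : JointlyLarge G (half T'.graph c d) (half σ.graph (E.ρ E.a) (E.ρ E.b)))
    (h₂ : JointlyLarge G (half T'.graph c d) (half σ.graph (E.ρ E.b) (E.ρ E.a)))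
    {v : F.R.V} (hv : F.π v = E.vertex) (hvF : ∀ g : G, g • F.vertex ≠ F.π v) :
    v ∈ half F.R.graph F.a F.b := by
  by_contra hcon
  obtain ⟨k, hk, hsub⟩ := F.exists_adj_of_mem_half hvF ((mem_half_swap F.R.isTree F.adj).2 hcon)
  obtain ⟨x, hx⟩ := Quotient.exists_rep (F.ρ F.a)
  refine E.not_jointlyLarge (U := half T'.graph c d) hk ?_ x (F.π F.a) (fun g hg => ?_) ⟨h₁, h₂⟩
  · rw [hv]; exact left_mem_half _ _
  · rw [← F.hπ.equivariant]
    refine hsub _ (F.ρ_mem_half.1 ?_)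
    have hgx : g • F.ρ F.a = Quotient.mk (T'.sideSetoid c₀ d₀) (g • x) :=
      (congrArg (g • ·) hx).symm
    rw [F.hρ.equivariant, hgx, hFa, hFb]
    exact ((T'.edgeSplitting_isCollapse hT' hcd₀).map_mem_half_iff hcd (fun h => h hO)).2 hg

end GTree.Enclosure

/-! ### Recovering a bipartite tree from the betweenness of its vertices of one color -/

theorem GTree.IsMinimal.exists_adj_ne {T : GTree G} (hT : T.IsMinimal) {x n : T.V} (hn : T.graph.Adj x n) :
    ∃ m, T.graph.Adj x m ∧ m ≠ n := by
  obtain ⟨g, hx, hy⟩ := hT.isLarge_half hn x n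
  have hne : g • x ≠ g • n := ((T.adj_smul g).2 hn).ne
  obtain ⟨z, hz, hzx⟩ : ∃ z ∈ half T.graph x n, x ≠ z := by
    by_cases h : x = g • x
    · exact ⟨_, hy, fun h' => hne (h.symm.trans h')⟩
    · exact ⟨_, hx, h⟩
  obtain ⟨m, hm, hzm⟩ := exists_adj_mem_half T.isTree hzx
  refine ⟨m, hm, ?_⟩
  rintro rfl
  exact notMem_half_swap T.isTree hn hz hzm

namespace BipartiteGTree

/-- An equivariant correspondence between the `V₀`-vertices of two bipartite trees that preserves
betweenness. -/
structure Correspondence (T₁ T₂ : BipartiteGTree G) (R : T₁.V → T₂.V → Prop) : Prop where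
  mem_left : ∀ {x x'}, R x x' → x ∈ T₁.V₀
  mem_right : ∀ {x x'}, R x x' → x' ∈ T₂.V₀
  total_left : ∀ x ∈ T₁.V₀, ∃ x', R x x'
  total_right : ∀ x' ∈ T₂.V₀, ∃ x, R x x'
  smul : ∀ (g : G) {x x'}, R x x' → R (g • x) (g • x')
  between : ∀ {x x' y y' z z'}, R x x' → R y y' → R z z' →
    (Between T₁.graph x y z ↔ Between T₂.graph x' y' z')

variable {T₁ T₂ : BipartiteGTree G} {R : T₁.V → T₂.V → Prop}

namespace Correspondence

theorem swap (h : Correspondence T₁ T₂ R) : Correspondence T₂ T₁ (fun x y => R y x) where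
  mem_left := h.mem_right
  mem_right := h.mem_left
  total_left := h.total_right
  total_right := h.total_left
  smul g _ _ hx := h.smul g hx
  between h1 h2 h3 := (h.between h1 h2 h3).symm

theorem right_unique (h : Correspondence T₁ T₂ R) {x x' x'' } (h1 : R x x') (h2 : R x x'') :
    x' = x'' :=
  (eq_of_between_self T₂.isTree ((h.between h1 h2 h1).1 fun _ _ _ hx _ => hx)).symm

theorem left_unique (h : Correspondence T₁ T₂ R) {x y z} (h1 : R x z) (h2 : R y z) : x = y :=
  h.swap.right_unique h1 h2

/-- Two `V₀`-vertices with a common neighbour correspond to vertices with a common neighbour. -/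
theorem exists_common_neighbor (h : Correspondence T₁ T₂ R) {x v w : T₁.V} {v' w' : T₂.V}
    (hv : R v v') (hw : R w w') (hxv : T₁.graph.Adj x v) (hxw : T₁.graph.Adj x w) (hvw : v ≠ w) :
    ∃ x', T₂.graph.Adj x' v' ∧ T₂.graph.Adj x' w' := by
  have hne : v' ≠ w' := fun heq => hvw (h.left_unique hv (heq ▸ hw))
  obtain ⟨x', hx', hwx'⟩ := exists_adj_mem_half T₂.isTree hne
  have hx'V : x' ∉ T₂.V₀ := (T₂.adj_color _ _ hx').1 (h.mem_right hv)
  have hxw' : x' ≠ w' := fun heq => hx'V (heq ▸ h.mem_right hw)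
  obtain ⟨y', hy', hwy'⟩ := exists_adj_mem_half T₂.isTree hxw'
  refine ⟨x', hx'.symm, ?_⟩
  have hvy' : v' ≠ y' := by
    rintro rfl
    exact notMem_half_swap T₂.isTree hx' hwy' hwx'
  by_cases hyw : w' = y'
  · rwa [hyw]
  have hy'V : y' ∈ T₂.V₀ := (T₂.adj_color _ _ hy'.symm).2 hx'V
  obtain ⟨y, hy⟩ := h.total_right y' hy'V
  have hbt := (h.between hv hy hw).2 (between_of_adj T₂.isTree hx'.symm hy' hvy' hwy' hyw)
  have hyx : y ≠ x := by
    rintro rfl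
    exact (T₁.adj_color _ _ hxv).1 (h.mem_left hy) (h.mem_left hv)
  rcases eq_or_eq_of_between T₁.isTree hxv hxw hyx hbt with rfl | rfl
  · exact absurd (h.right_unique hv hy) hvy'
  · exact absurd (h.right_unique hw hy) hyw

theorem adj_of_adj (h : Correspondence T₁ T₂ R) {x v w y : T₁.V} {x' v' w' y' : T₂.V}
    (hv : R v v') (hw : R w w') (hy : R y y') (hvw : v ≠ w)
    (hxv : T₁.graph.Adj x v) (hxw : T₁.graph.Adj x w)
    (hxv' : T₂.graph.Adj x' v') (hxw' : T₂.graph.Adj x' w') (hxy : T₁.graph.Adj x y) :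
    T₂.graph.Adj x' y' := by
  have hx'V : x' ∉ T₂.V₀ := (T₂.adj_color _ _ hxv'.symm).1 (h.mem_right hv)
  have hne : v' ≠ w' := fun heq => hvw (h.left_unique hv (heq ▸ hw))
  have hxy' : x' ≠ y' := fun heq => hx'V (heq ▸ h.mem_right hy)
  obtain ⟨m', hm', hym'⟩ := exists_adj_mem_half T₂.isTree hxy'
  by_cases hmy : y' = m'
  · rwa [hmy]
  obtain ⟨m, hm⟩ := h.total_right m' ((T₂.adj_color _ _ hm'.symm).2 hx'V)
  have hmx : m ≠ x := by
    rintro rfl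
    exact (T₁.adj_color _ _ hxv).1 (h.mem_left hm) (h.mem_left hv)
  have key : ∀ {a a'}, R a a' → T₁.graph.Adj x a → T₂.graph.Adj x' a' → a' = m' := by
    intro a a' ha hxa hxa'
    by_contra ham
    have hbt := (h.between ha hm hy).2 (between_of_adj T₂.isTree hxa' hm' ham hym' hmy)
    rcases eq_or_eq_of_between T₁.isTree hxa hxy hmx hbt with rfl | rfl
    · exact ham (h.right_unique ha hm)
    · exact hmy (h.right_unique hy hm)
  exact absurd ((key hv hxv hxv').trans (key hw hxw hxw').symm) hne

/-- The extension of a correspondence to all vertices: vertices of the other color correspond if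
their neighbours do. -/
def Extension (T₁ T₂ : BipartiteGTree G) (R : T₁.V → T₂.V → Prop) (x : T₁.V) (x' : T₂.V) : Prop :=
  R x x' ∨ (x ∉ T₁.V₀ ∧ x' ∉ T₂.V₀ ∧
    ∀ v v', R v v' → (T₁.graph.Adj x v ↔ T₂.graph.Adj x' v'))

theorem extension_mem (h : Correspondence T₁ T₂ R) {x x'} (hx : Extension T₁ T₂ R x x') :
    x ∈ T₁.V₀ ↔ x' ∈ T₂.V₀ := by
  rcases hx with hx | ⟨h1, h2, -⟩
  · exact iff_of_true (h.mem_left hx) (h.mem_right hx)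
  · exact iff_of_false h1 h2

theorem extension_total (h : Correspondence T₁ T₂ R) (hT₁ : T₁.IsMinimal) (x : T₁.V) :
    ∃ x', Extension T₁ T₂ R x x' := by
  by_cases hx : x ∈ T₁.V₀
  · obtain ⟨x', hx'⟩ := h.total_left x hx
    exact ⟨x', Or.inl hx'⟩
  by_cases hn : ∃ v, T₁.graph.Adj x v
  · obtain ⟨v, hv⟩ := hn
    obtain ⟨w, hw, hwv⟩ := hT₁.exists_adj_ne hv
    obtain ⟨v', hvv⟩ := h.total_left v ((T₁.adj_color _ _ hv.symm).2 hx)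
    obtain ⟨w', hww⟩ := h.total_left w ((T₁.adj_color _ _ hw.symm).2 hx)
    obtain ⟨x', hxv', hxw'⟩ := h.exists_common_neighbor hvv hww hv hw hwv.symm
    have hne : v' ≠ w' := fun heq => hwv.symm (h.left_unique hvv (heq ▸ hww))
    refine ⟨x', Or.inr ⟨hx, (T₂.adj_color _ _ hxv'.symm).1 (h.mem_right hvv), ?_⟩⟩
    intro y y' hy
    exact ⟨h.adj_of_adj hvv hww hy hwv.symm hv hw hxv' hxw',
      h.swap.adj_of_adj hvv hww hy hne hxv' hxw' hv hw⟩
  · -- a tree with an isolated vertex is a point, and then the other tree has no `V₀`-vertices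
    have hR : ∀ v v', ¬ R v v' := by
      intro v v' hvv
      have hne : x ≠ v := fun heq => hx (heq ▸ h.mem_left hvv)
      obtain ⟨n, hn', -⟩ := exists_adj_mem_half T₁.isTree hne
      exact hn ⟨n, hn'⟩
    obtain ⟨x'⟩ := T₂.isTree.connected.nonempty
    refine ⟨x', Or.inr ⟨hx, fun hx' => ?_, fun v v' hvv => absurd hvv (hR v v')⟩⟩
    obtain ⟨y, hy⟩ := h.total_right x' hx'
    exact hR _ _ hy

theorem extension_swap {x x'} (hx : Extension T₁ T₂ R x x') :
    Extension T₂ T₁ (fun a b => R b a) x' x :=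
  hx.imp id fun ⟨h1, h2, h3⟩ => ⟨h2, h1, fun v v' hv => (h3 v' v hv).symm⟩

theorem extension_unique (h : Correspondence T₁ T₂ R) (hT₂ : T₂.IsMinimal) {x x' x''}
    (h1 : Extension T₁ T₂ R x x') (h2 : Extension T₁ T₂ R x x'') : x' = x'' := by
  rcases h1 with h1 | ⟨h1, h1', h1R⟩
  · rcases h2 with h2 | ⟨h2, -, -⟩
    · exact h.right_unique h1 h2
    · exact absurd (h.mem_left h1) h2
  rcases h2 with h2 | ⟨-, h2', h2R⟩
  · exact absurd (h.mem_left h2) h1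
  by_contra hne
  obtain ⟨v', hv', -⟩ := exists_adj_mem_half T₂.isTree hne
  obtain ⟨w', hw', hwv⟩ := hT₂.exists_adj_ne hv'
  have key : ∀ y', T₂.graph.Adj x' y' → T₂.graph.Adj x'' y' := by
    intro y' hy'
    obtain ⟨y, hy⟩ := h.total_right y' ((T₂.adj_color _ _ hy'.symm).2 h1')
    exact (h2R y y' hy).1 ((h1R y y' hy).2 hy')
  exact hne (eq_of_two_common_neighbors T₂.isTree hv' hw' (key _ hv') (key _ hw') hwv.symm)

theorem extension_smul (h : Correspondence T₁ T₂ R) (g : G) {x x'}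
    (hx : Extension T₁ T₂ R x x') : Extension T₁ T₂ R (g • x) (g • x') := by
  rcases hx with hx | ⟨h1, h2, h3⟩
  · exact Or.inl (h.smul g hx)
  · refine Or.inr ⟨fun hc => h1 ((T₁.smul_mem g x).1 hc), fun hc => h2 ((T₂.smul_mem g x').1 hc),
      fun v v' hv => ?_⟩
    have := h3 _ _ (h.smul g⁻¹ hv)
    rwa [← T₁.adj_smul g, ← T₂.adj_smul g, smul_inv_smul, smul_inv_smul] at this

theorem extension_adj (h : Correspondence T₁ T₂ R) {x x' y y'} (hx : Extension T₁ T₂ R x x')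
    (hy : Extension T₁ T₂ R y y') (hxy : T₁.graph.Adj x y) : T₂.graph.Adj x' y' := by
  have hcol := T₁.adj_color x y hxy
  rcases hx with hx | ⟨hx, -, hxR⟩
  · rcases hy with hy | ⟨-, -, hyR⟩
    · exact absurd (h.mem_left hy) (hcol.1 (h.mem_left hx))
    · exact ((hyR _ _ hx).1 hxy.symm).symm
  · rcases hy with hy | ⟨hy, -, -⟩
    · exact (hxR _ _ hy).1 hxy
    · exact absurd (hcol.2 hy) hx

theorem exists_isomorphism (h : Correspondence T₁ T₂ R) (hT₁ : T₁.IsMinimal)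
    (hT₂ : T₂.IsMinimal) :
    ∃ φ : T₁.graph ≃g T₂.graph,
      GTree.IsEquivariant (T := T₁.toGTree) (T' := T₂.toGTree) φ ∧
        ∀ v : T₁.V, v ∈ T₁.V₀ ↔ φ v ∈ T₂.V₀ := by
  choose f hf using h.extension_total hT₁
  choose f' hf' using h.swap.extension_total hT₂
  have hl : ∀ x, f' (f x) = x := fun x =>
    h.swap.extension_unique hT₁ (hf' (f x)) (extension_swap (hf x))
  have hr : ∀ x, f (f' x) = x := fun x =>
    h.extension_unique hT₂ (hf (f' x)) (extension_swap (hf' x))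
  refine ⟨⟨⟨f, f', hl, hr⟩, ?_⟩, ?_, fun v => h.extension_mem (hf v)⟩
  · intro x y
    refine ⟨fun hxy => ?_, h.extension_adj (hf x) (hf y)⟩
    exact h.swap.extension_adj (extension_swap (hf x)) (extension_swap (hf y)) hxy
  · intro g v
    exact h.extension_unique hT₂ (hf (g • v)) (h.extension_smul g (hf v))

end Correspondence

end BipartiteGTree

/-! ### Regions between edges, without an isomorphism hypothesis -/

namespace GTree

theorem Isomorphic.symm {T T' : GTree G} (h : Isomorphic T T') : Isomorphic T' T := by
  obtain ⟨φ, hφ⟩ := h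
  refine ⟨φ.symm, fun g v => φ.injective ?_⟩
  rw [hφ]
  simp

theorem Isomorphic.trans {T T' T'' : GTree G} (h : Isomorphic T T') (h' : Isomorphic T' T'') :
    Isomorphic T T'' := by
  obtain ⟨φ, hφ⟩ := h
  obtain ⟨ψ, hψ⟩ := h'
  exact ⟨φ.trans ψ, fun g v => (congrArg ψ (hφ g v)).trans (hψ g _)⟩

/-- The conclusion of `isLarge_inter` for splittings that may be isomorphic to the one given by the
edge `{c, d}` of `T`.  Here two splittings are enclosed on the side of `c`, and the tripod spanned
by their vertices and a vertex `y` on the side of `d` is not degenerate at an end where this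
isomorphism occurs.  If both ends are of this kind, the region in question contains a half of `T`;
if only `σ` is, it contains a large region next to the second enclosed edge. -/
theorem Enclosure.isLarge_inter_of_not_between {T : GTree G} {σ σ' : Splitting G}
    (hT : T.IsMinimal) {c d : T.V} (hcd : T.graph.Adj c d) {y : T.V} (hy : y ∉ half T.graph c d)
    (E : Enclosure T σ) (E' : Enclosure T σ')
    (hE : E.vertex ∈ half T.graph c d) (hE' : E'.vertex ∈ half T.graph c d)
    (h : Isomorphic (T.edgeSplitting hT hcd).toGTree σ.toGTree →
      ¬ Between T.graph y E.vertex E'.vertex)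
    (h' : Isomorphic (T.edgeSplitting hT hcd).toGTree σ'.toGTree →
      ¬ Between T.graph y E'.vertex E.vertex) :
    IsLarge G (E.π ⁻¹' half T.graph c d ∩ half E.R.graph E.a E.b) := by
  have hTt := T.isTree
  by_cases hiso : Isomorphic (T.edgeSplitting hT hcd).toGTree σ.toGTree
  swap
  · exact E.isLarge_inter hT hcd hE hiso
  by_contra hnL
  -- the side of `d` lies on the side of `E.a`, since otherwise the region contains a half
  have hdc : ∀ z, E.π z ∈ half T.graph d c → z ∈ half E.R.graph E.a E.b := by
    refine (E.half_subset_or hcd hE).resolve_right fun hb => hnL ?_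
    refine (E.isLarge_half hT E.adj).mono fun z hz => ⟨?_, hz⟩
    by_contra hz'
    exact notMem_half_swap E.R.isTree E.adj hz (hb z ((mem_half_swap hTt hcd).2 hz'))
  obtain ⟨y', hy'⟩ := E.hπ.surjective y
  have hydc : y ∈ half T.graph d c := (mem_half_swap hTt hcd).2 hy
  -- an edge separating the vertex of `E` from `y` and the vertex of `E'`
  have hbt := h hiso
  simp only [Between, not_forall] at hbt
  obtain ⟨r₁, r₂, hr, hyr, hE'r, hEr⟩ := hbt
  have hrsub : ∀ z, E.π z ∈ half T.graph r₁ r₂ → z ∈ half E.R.graph E.a E.b := by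
    refine (E.half_subset_or hr.symm ((mem_half_swap hTt hr).2 hEr)).resolve_right fun hb => ?_
    exact notMem_half_swap E.R.isTree E.adj (hdc y' (hy' ▸ hydc)) (hb y' (hy' ▸ hyr))
  have hQ : ¬ IsLarge G (half T.graph r₁ r₂ ∩ half T.graph c d) := fun hL =>
    hnL ((E.hπ.isLarge_preimage hL).mono fun z hz => ⟨hz.2, hrsub z hz.1⟩)
  by_cases hiso' : Isomorphic (T.edgeSplitting hT hcd).toGTree σ'.toGTree
  · -- an edge separating the vertex of `E'` from the others bounds a half inside the region
    have hbt' := h' hiso'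
    simp only [Between, not_forall] at hbt'
    obtain ⟨t₁, t₂, ht, hyt, hEt, hE't⟩ := hbt'
    refine hQ ((hT.isLarge_half ht.symm).mono fun z hz => ⟨?_, ?_⟩)
    · exact half_subset_of_corners hTt ht hr hyt hyr hEt hEr hE't hE'r hz
    · exact half_subset_of_corners hTt ht hcd hEt hE hyt hy hE't hE' hz
  · have key : ∀ F : Enclosure T σ', F.vertex ∈ half T.graph c d → F.vertex ∈ half T.graph r₁ r₂ →
        (∀ z, F.π z ∈ half T.graph d c → z ∈ half F.R.graph F.a F.b) → False := by
      intro F hF hFr hdc'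
      rcases F.half_subset_or hr hFr with hb | hb
      · -- the other side of the enclosed edge lies inside the region
        refine hQ fun u v => ?_
        obtain ⟨u, rfl⟩ := F.hπ.surjective u
        obtain ⟨v, rfl⟩ := F.hπ.surjective v
        obtain ⟨g, hu, hv⟩ := F.isLarge_half hT F.adj.symm u v
        have hin : ∀ z ∈ half F.R.graph F.b F.a,
            F.π z ∈ half T.graph r₁ r₂ ∩ half T.graph c d := by
          intro z hz
          have hz' := notMem_half_swap F.R.isTree F.adj.symm hz
          refine ⟨?_, ?_⟩
          · by_contra hc
            exact hz' (hb z ((mem_half_swap hTt hr).2 hc))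
          · by_contra hc
            exact hz' (hdc' z ((mem_half_swap hTt hcd).2 hc))
        exact ⟨g, F.hπ.equivariant g u ▸ hin _ hu, F.hπ.equivariant g v ▸ hin _ hv⟩
      · refine hQ fun u v => ?_
        obtain ⟨u, rfl⟩ := F.hπ.surjective u
        obtain ⟨v, rfl⟩ := F.hπ.surjective v
        obtain ⟨g, hu, hv⟩ := F.isLarge_inter hT hcd hF hiso' u v
        have hin : ∀ z ∈ F.π ⁻¹' half T.graph c d ∩ half F.R.graph F.a F.b,
            F.π z ∈ half T.graph r₁ r₂ ∩ half T.graph c d := by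
          rintro z ⟨hz₁, hz₂⟩
          refine ⟨?_, hz₁⟩
          by_contra hc
          exact notMem_half_swap F.R.isTree F.adj hz₂ (hb z ((mem_half_swap hTt hr).2 hc))
        exact ⟨g, F.hπ.equivariant g u ▸ hin _ hu, F.hπ.equivariant g v ▸ hin _ hv⟩
    rcases E'.half_subset_or hcd hE' with hb | hb
    · exact key E' hE' hE'r hb
    · exact key E'.swap (by rwa [E'.vertex_swap]) (by rwa [E'.vertex_swap]) hb

end GTree

/-! ### Comparing two regular neighborhoods -/

namespace BipartiteGTree

variable {J : Type w}

/-- A choice, for each member of a family of splittings with given base edges `{s j, t j}`, of a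
`V₀`-vertex of `T` at which this base edge is enclosed; for an isolated member the vertex is
required to be isolated. -/
structure Marking (σ : J → Splitting G) (s t : ∀ j, (σ j).V) (T : BipartiteGTree G) where
  minimal : T.IsMinimal
  E : ∀ j, GTree.Enclosure T.toGTree (σ j)
  ρ_a : ∀ j, (E j).ρ (E j).a = s j
  ρ_b : ∀ j, (E j).ρ (E j).b = t j
  mem : ∀ j, (E j).vertex ∈ T.V₀
  isolated : ∀ j, Splitting.IsIsolated σ j → T.HasTwoFixedNeighbors (E j).vertex
  surj : ∀ v ∈ T.V₀, ∃ (j : J) (g : G), v = g • (E j).vertex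

namespace Marking

variable {σ : J → Splitting G} {s t : ∀ j, (σ j).V} {T T₁ T₂ : BipartiteGTree G}

/-- The vertex at which the translate by `x.2` of the base edge of the splitting `x.1` is
enclosed. -/
def place (M : Marking σ s t T) (x : J × G) : T.V := x.2 • (M.E x.1).vertex

/-- The enclosure of the translate by `x.2` of the base edge of the splitting `x.1`. -/
def enc (M : Marking σ s t T) (x : J × G) : GTree.Enclosure T.toGTree (σ x.1) :=
  (M.E x.1).smul x.2

theorem enc_vertex (M : Marking σ s t T) (x : J × G) : (M.enc x).vertex = M.place x :=
  (M.E x.1).vertex_smul x.2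

theorem enc_ρ_a (M : Marking σ s t T) (x : J × G) :
    (M.enc x).ρ (M.enc x).a = x.2 • s x.1 := by
  rw [← M.ρ_a]; exact (M.E x.1).hρ.equivariant _ _

theorem enc_ρ_b (M : Marking σ s t T) (x : J × G) :
    (M.enc x).ρ (M.enc x).b = x.2 • t x.1 := by
  rw [← M.ρ_b]; exact (M.E x.1).hρ.equivariant _ _

theorem place_mem (M : Marking σ s t T) (x : J × G) : M.place x ∈ T.V₀ :=
  (T.smul_mem _ _).2 (M.mem x.1)

theorem smul_ne (M : Marking σ s t T) {u : T.V} (hu : u ∉ T.V₀) (x : J × G) (g : G) :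
    g • u ≠ M.place x := fun h => hu ((T.smul_mem g u).1 (h ▸ M.place_mem x))

theorem isIsolated_of_isomorphic (M : Marking σ s t T) {c d : T.V} (hcd : T.graph.Adj c d) {j : J}
    (h : GTree.Isomorphic (T.toGTree.edgeSplitting M.minimal hcd).toGTree (σ j).toGTree) :
    Splitting.IsIsolated σ j :=
  Splitting.IsIsolated.of_isomorphic M.minimal (fun j => ⟨M.E j⟩) hcd h

theorem exists_isolatedSides (M : Marking σ s t T) (x : J × G)
    (hx : T.HasTwoFixedNeighbors (M.place x)) :
    ∃ na nb, GTree.Enclosure.IsolatedSides M.minimal (M.enc x) na nb := by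
  rw [← M.enc_vertex] at hx
  refine GTree.Enclosure.exists_isolatedSides _ M.minimal hx fun n hn g => ?_
  rw [M.enc_vertex] at hn ⊢
  exact M.smul_ne (fun hc => (T.adj_color _ _ hn).1 hc (M.place_mem x)) x g

/-- Both sides of an enclosed edge meet one half of `T` jointly, in terms of the base edges. -/
theorem jointlyLarge (M : Marking σ s t T) (x : J × G) {c d : T.V}
    (h₁ : IsLarge G ((M.enc x).π ⁻¹' half T.graph c d ∩
      half (M.enc x).R.graph (M.enc x).a (M.enc x).b))
    (h₂ : IsLarge G ((M.enc x).swap.π ⁻¹' half T.graph c d ∩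
      half (M.enc x).swap.R.graph (M.enc x).swap.a (M.enc x).swap.b)) :
    JointlyLarge G (half T.graph c d) (half (σ x.1).graph (x.2 • s x.1) (x.2 • t x.1)) ∧
      JointlyLarge G (half T.graph c d) (half (σ x.1).graph (x.2 • t x.1) (x.2 • s x.1)) := by
  have h₁' := (M.enc x).jointlyLarge h₁
  have h₂' := (M.enc x).swap.jointlyLarge h₂
  change JointlyLarge G _ (half _ ((M.enc x).ρ (M.enc x).b) ((M.enc x).ρ (M.enc x).a)) at h₂'
  rw [M.enc_ρ_a, M.enc_ρ_b] at h₁' h₂'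
  exact ⟨h₁', h₂'⟩

theorem jointlyLarge_of_not_isomorphic (M : Marking σ s t T) (x : J × G) {c d : T.V}
    (hcd : T.graph.Adj c d) (hx : M.place x ∈ half T.graph c d)
    (hiso : ¬ GTree.Isomorphic (T.toGTree.edgeSplitting M.minimal hcd).toGTree (σ x.1).toGTree) :
    JointlyLarge G (half T.graph c d) (half (σ x.1).graph (x.2 • s x.1) (x.2 • t x.1)) ∧
      JointlyLarge G (half T.graph c d) (half (σ x.1).graph (x.2 • t x.1) (x.2 • s x.1)) := by
  rw [← M.enc_vertex] at hx
  refine M.jointlyLarge x ((M.enc x).isLarge_inter M.minimal hcd hx hiso)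
    ((M.enc x).swap.isLarge_inter M.minimal hcd ?_ hiso)
  rwa [GTree.Enclosure.vertex_swap]

/-- The side of an isolated vertex on which the other edges are enclosed is the same in both
trees.  Here `H` is a half of the isolated splitting. -/
theorem place_mem_side (M₁ : Marking σ s t T₁) (M₂ : Marking σ s t T₂)
    (hσ : ∀ j k : J, j ≠ k → ¬ GTree.Isomorphic (σ j).toGTree (σ k).toGTree)
    {y : J × G} {n₁ : T₁.V} {n₂ : T₂.V} {H : Set (σ y.1).V}
    (hn₁ : T₁.graph.Adj n₁ (M₁.enc y).vertex) (hn₂ : T₂.graph.Adj n₂ (M₂.enc y).vertex)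
    (h₁ : ∀ z, (M₁.enc y).ρ z ∈ H → (M₁.enc y).π z ∈ half T₁.graph n₁ (M₁.enc y).vertex ∨
      (M₁.enc y).π z = (M₁.enc y).vertex)
    (h₂ : ∀ z, (M₂.enc y).π z ∈ half T₂.graph n₂ (M₂.enc y).vertex → (M₂.enc y).ρ z ∈ H)
    (hpre : ∀ z, (M₁.enc y).π z = (M₁.enc y).vertex → z = (M₁.enc y).a ∨ z = (M₁.enc y).b)
    (hH : ¬ (y.2 • s y.1 ∈ H ∧ y.2 • t y.1 ∈ H))
    (hiso : GTree.Isomorphic (T₂.toGTree.edgeSplitting M₂.minimal hn₂).toGTree (σ y.1).toGTree)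
    (x : J × G) (hx : M₂.place x ∈ half T₂.graph n₂ (M₂.enc y).vertex) :
    M₁.place x ∈ half T₁.graph n₁ (M₁.enc y).vertex := by
  by_cases hxy : x.1 = y.1
  · obtain ⟨i, g⟩ := x
    obtain ⟨j, k⟩ := y
    obtain rfl : i = j := hxy
    set l : G := g * k⁻¹ with hl
    have hlk : ∀ {X : Type u} [MulAction G X] (p : X), g • p = l • k • p := by
      intro X _ p
      rw [hl, mul_smul, inv_smul_smul]
    have hp₁ : M₁.place (i, g) = (M₁.enc (i, k)).π (l • (M₁.enc (i, k)).a) := by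
      rw [GTree.IsCollapse.equivariant (M₁.enc (i, k)).hπ]
      change g • _ = l • (M₁.enc (i, k)).vertex
      rw [M₁.enc_vertex]
      exact hlk _
    have hp₂ : M₂.place (i, g) = l • (M₂.enc (i, k)).vertex := by
      rw [M₂.enc_vertex]
      exact hlk _
    have ha : l • k • s i ∈ H := by
      have := h₂ (l • (M₂.enc (i, k)).a) (by
        rw [GTree.IsCollapse.equivariant (M₂.enc (i, k)).hπ]
        rw [hp₂] at hx; exact hx)
      rwa [GTree.IsCollapse.equivariant (M₂.enc (i, k)).hρ, M₂.enc_ρ_a] at this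
    have hb : l • k • t i ∈ H := by
      have := h₂ (l • (M₂.enc (i, k)).b) (by
        rw [GTree.IsCollapse.equivariant (M₂.enc (i, k)).hπ, GTree.Enclosure.π_b]
        rw [hp₂] at hx; exact hx)
      rwa [GTree.IsCollapse.equivariant (M₂.enc (i, k)).hρ, M₂.enc_ρ_b] at this
    rw [hp₁]
    refine (h₁ _ ?_).resolve_right fun hv => ?_
    · rw [GTree.IsCollapse.equivariant (M₁.enc (i, k)).hρ, M₁.enc_ρ_a]
      exact ha
    · have hvb : (M₁.enc (i, k)).π (l • (M₁.enc (i, k)).b) = (M₁.enc (i, k)).vertex := by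
        rw [GTree.IsCollapse.equivariant (M₁.enc (i, k)).hπ, GTree.Enclosure.π_b]
        rwa [GTree.IsCollapse.equivariant (M₁.enc (i, k)).hπ] at hv
      have hρa : (M₁.enc (i, k)).ρ (l • (M₁.enc (i, k)).a) ∈ H := by
        rw [GTree.IsCollapse.equivariant (M₁.enc (i, k)).hρ, M₁.enc_ρ_a]; exact ha
      have hρb : (M₁.enc (i, k)).ρ (l • (M₁.enc (i, k)).b) ∈ H := by
        rw [GTree.IsCollapse.equivariant (M₁.enc (i, k)).hρ, M₁.enc_ρ_b]; exact hb
      have hne := (((M₁.enc (i, k)).R.adj_smul l).2 (M₁.enc (i, k)).adj).ne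
      have hra := M₁.enc_ρ_a (i, k)
      have hrb := M₁.enc_ρ_b (i, k)
      apply hH
      rcases hpre _ hv with h3 | h3 <;> rcases hpre _ hvb with h4 | h4
      · exact absurd (h3.trans h4.symm) hne
      · rw [h3, hra] at hρa
        rw [h4, hrb] at hρb
        exact ⟨hρa, hρb⟩
      · rw [h3, hrb] at hρa
        rw [h4, hra] at hρb
        exact ⟨hρb, hρa⟩
      · exact absurd (h3.trans h4.symm) hne
  · have hniso : ¬ GTree.Isomorphic (T₂.toGTree.edgeSplitting M₂.minimal hn₂).toGTree
        (σ x.1).toGTree := fun h => hσ _ _ hxy (h.symm.trans hiso)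
    have hJL := M₂.jointlyLarge_of_not_isomorphic x hn₂ hx hniso
    by_contra hcon
    have hv : (M₁.enc x).vertex ∈ half T₁.graph (M₁.enc y).vertex n₁ := by
      rw [M₁.enc_vertex x]
      exact (mem_half_swap T₁.isTree hn₁).2 hcon
    obtain ⟨z, hz⟩ := (M₁.enc y).hπ.surjective n₁
    obtain ⟨z', hz'⟩ := (M₂.enc y).hρ.surjective ((M₁.enc y).ρ z)
    have hnj := (M₁.enc x).not_jointlyLarge (U := half T₂.graph n₂ (M₂.enc y).vertex) hn₁.symm hv
      ((M₂.enc y).π z') n₁ (fun g hg => ?_)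
    · rw [M₁.enc_ρ_a, M₁.enc_ρ_b] at hnj
      exact hnj hJL
    · rw [← GTree.IsCollapse.equivariant (M₂.enc y).hπ] at hg
      have h3 := h₂ _ hg
      rw [GTree.IsCollapse.equivariant (M₂.enc y).hρ, hz',
        ← GTree.IsCollapse.equivariant (M₁.enc y).hρ] at h3
      have h4 := h₁ _ h3
      rw [GTree.IsCollapse.equivariant (M₁.enc y).hπ, hz] at h4
      refine h4.resolve_right ?_
      rw [M₁.enc_vertex] at hn₁ ⊢
      exact M₁.smul_ne (fun hc => (T₁.adj_color _ _ hn₁).1 hc (M₁.place_mem y)) y g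

/-- Betweenness with an isolated splitting in the middle does not depend on the tree. -/
theorem between_of_isolated (M₁ : Marking σ s t T₁) (M₂ : Marking σ s t T₂)
    (hσ : ∀ j k : J, j ≠ k → ¬ GTree.Isomorphic (σ j).toGTree (σ k).toGTree)
    {x y z : J × G} (hy : Splitting.IsIsolated σ y.1)
    (h : Between T₁.graph (M₁.place x) (M₁.place y) (M₁.place z)) :
    Between T₂.graph (M₂.place x) (M₂.place y) (M₂.place z) := by
  obtain ⟨a₁, b₁, S₁⟩ := M₁.exists_isolatedSides y ((M₁.isolated _ hy).smul _)
  obtain ⟨a₂, b₂, S₂⟩ := M₂.exists_isolatedSides y ((M₂.isolated _ hy).smul _)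
  have hne : a₂ ≠ b₂ := by
    intro heq
    obtain ⟨p, hp⟩ := (M₂.enc y).hπ.surjective a₂
    refine notMem_half_swap (M₂.enc y).R.isTree (M₂.enc y).adj
      (S₂.side_a p (hp ▸ left_mem_half _ _)) (S₂.side_b p ?_)
    rw [hp, heq]
    exact left_mem_half _ _
  rw [← M₁.enc_vertex y] at h
  rw [← M₂.enc_vertex y]
  have hadj : (σ y.1).graph.Adj (y.2 • s y.1) (y.2 • t y.1) := by
    have := (M₁.enc y).ρ_adj
    rwa [M₁.enc_ρ_a, M₁.enc_ρ_b] at this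
  have hρ : ∀ {T : BipartiteGTree G} (M : Marking σ s t T) (p : (M.enc y).R.V),
      (M.enc y).ρ p ∈ half (σ y.1).graph (y.2 • s y.1) (y.2 • t y.1) ↔
        p ∈ half (M.enc y).R.graph (M.enc y).a (M.enc y).b := by
    intro T M p
    rw [← (M.enc y).ρ_mem_half, M.enc_ρ_a, M.enc_ρ_b]
  have hρ' : ∀ {T : BipartiteGTree G} (M : Marking σ s t T) (p : (M.enc y).R.V),
      (M.enc y).ρ p ∈ half (σ y.1).graph (y.2 • t y.1) (y.2 • s y.1) ↔
        p ∈ half (M.enc y).R.graph (M.enc y).b (M.enc y).a := by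
    intro T M p
    rw [mem_half_swap (σ y.1).isTree hadj, mem_half_swap (M.enc y).R.isTree (M.enc y).adj, hρ]
  have hsa : ∀ p : J × G, M₂.place p ∈ half T₂.graph a₂ (M₂.enc y).vertex →
      M₁.place p ∈ half T₁.graph a₁ (M₁.enc y).vertex := by
    refine M₁.place_mem_side M₂ hσ (H := half (σ y.1).graph (y.2 • s y.1) (y.2 • t y.1))
      S₁.adj_a S₂.adj_a (fun p hp => ?_) (fun p hp => (hρ M₂ p).2 (S₂.side_a p hp))
      S₁.preimage (fun hc => notMem_half_of_mem (σ y.1).isTree hadj hc.2) S₂.iso_a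
    have hpa := (hρ M₁ p).1 hp
    rcases S₁.cover ((M₁.enc y).π p) with h3 | h3 | h3
    · exact Or.inl h3
    · exact Or.inr h3
    · exact absurd (S₁.side_b p h3) (notMem_half_swap (M₁.enc y).R.isTree (M₁.enc y).adj hpa)
  have hsb : ∀ p : J × G, M₂.place p ∈ half T₂.graph b₂ (M₂.enc y).vertex →
      M₁.place p ∈ half T₁.graph b₁ (M₁.enc y).vertex := by
    refine M₁.place_mem_side M₂ hσ (H := half (σ y.1).graph (y.2 • t y.1) (y.2 • s y.1))
      S₁.adj_b S₂.adj_b (fun p hp => ?_) (fun p hp => (hρ' M₂ p).2 (S₂.side_b p hp))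
      S₁.preimage (fun hc => notMem_half_of_mem (σ y.1).isTree hadj.symm hc.1) S₂.iso_b
    have hpb := (hρ' M₁ p).1 hp
    rcases S₁.cover ((M₁.enc y).π p) with h3 | h3 | h3
    · exact absurd (S₁.side_a p h3)
        (notMem_half_swap (M₁.enc y).R.isTree (M₁.enc y).adj.symm hpb)
    · exact Or.inr h3
    · exact Or.inl h3
  have hbt : ∀ {n : T₁.V}, T₁.graph.Adj n (M₁.enc y).vertex →
      M₁.place x ∈ half T₁.graph n (M₁.enc y).vertex →
      M₁.place z ∉ half T₁.graph n (M₁.enc y).vertex := fun hn hx hz =>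
    notMem_half_of_mem T₁.isTree hn (h _ _ hn hx hz)
  rcases S₂.cover (M₂.place x) with hx | hx | hx
  · rcases S₂.cover (M₂.place z) with hz | hz | hz
    · exact absurd (hsa z hz) (hbt S₁.adj_a (hsa x hx))
    · rw [hz]; exact between_right _ _
    · exact between_of_mem_half T₂.isTree S₂.adj_a S₂.adj_b hne hx hz
  · rw [hx]; exact between_left _ _
  · rcases S₂.cover (M₂.place z) with hz | hz | hz
    · exact between_of_mem_half T₂.isTree S₂.adj_b S₂.adj_a hne.symm hx hz
    · rw [hz]; exact between_right _ _
    · exact absurd (hsb z hz) (hbt S₁.adj_b (hsb x hx))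

/-- Betweenness of the places of enclosed edges carries over from one tree to another in whose
`V₀`-vertices the same splittings are enclosed.  If it failed, an edge of the second tree would
separate the middle place from the two others; inserted at a `V₁`-vertex of the first tree, it would
separate the corresponding places there. -/
theorem between_imp (M₁ : Marking σ s t T₁) (M₂ : Marking σ s t T₂)
    (hσ : ∀ j k : J, j ≠ k → ¬ GTree.Isomorphic (σ j).toGTree (σ k).toGTree)
    (hV₁ : ∀ τ : Splitting G,
      (∀ j, τ.SandwichedBy (σ j) ∧ τ.IntersectionNumberZero (σ j)) →
        ∃ v, v ∉ T₁.V₀ ∧ T₁.Encloses v τ)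
    {x y z : J × G} (h : Between T₁.graph (M₁.place x) (M₁.place y) (M₁.place z)) :
    Between T₂.graph (M₂.place x) (M₂.place y) (M₂.place z) := by
  by_cases hy : Splitting.IsIsolated σ y.1
  · exact between_of_isolated M₁ M₂ hσ hy h
  by_contra hcon
  by_cases hI : ∃ p : J × G, Splitting.IsIsolated σ p.1 ∧
      Between T₂.graph (M₂.place y) (M₂.place p) (M₂.place x) ∧
      Between T₂.graph (M₂.place y) (M₂.place p) (M₂.place z)
  · obtain ⟨p, hp, hpx, hpz⟩ := hI
    refine not_between_of_between T₁.isTree ?_ (between_of_isolated M₂ M₁ hσ hp hpx)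
      (between_of_isolated M₂ M₁ hσ hp hpz) h
    -- a splitting enclosed at an isolated vertex is isolated
    intro heq
    obtain ⟨na, nb, S⟩ := M₁.exists_isolatedSides y (heq ▸ (M₁.isolated _ hp).smul _)
    exact hy (M₁.isIsolated_of_isomorphic S.adj_a S.iso_a)
  · have hI' : ∀ p : J × G, Splitting.IsIsolated σ p.1 →
        Between T₂.graph (M₂.place y) (M₂.place p) (M₂.place x) →
        ¬ Between T₂.graph (M₂.place y) (M₂.place p) (M₂.place z) :=
      fun p hp hpx hpz => hI ⟨p, hp, hpx, hpz⟩
    simp only [Between, not_forall] at hcon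
    obtain ⟨c, d, hcd, hxc, hzc, hyc⟩ := hcon
    -- both sides of the enclosed edges meet the half of `c`, respectively the half of `d`
    have hxz : ∀ {x z : J × G}, M₂.place x ∈ half T₂.graph c d →
        M₂.place z ∈ half T₂.graph c d →
        (Splitting.IsIsolated σ x.1 →
          ¬ Between T₂.graph (M₂.place y) (M₂.place x) (M₂.place z)) →
        (Splitting.IsIsolated σ z.1 →
          ¬ Between T₂.graph (M₂.place y) (M₂.place z) (M₂.place x)) →
        JointlyLarge G (half T₂.graph c d)
            (half (σ x.1).graph (x.2 • s x.1) (x.2 • t x.1)) ∧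
          JointlyLarge G (half T₂.graph c d)
            (half (σ x.1).graph (x.2 • t x.1) (x.2 • s x.1)) := by
      intro x z hx hz hxb hzb
      have hsx := (M₂.enc x).vertex_swap
      rw [← M₂.enc_vertex] at hx hz
      rw [← M₂.enc_vertex x, ← M₂.enc_vertex z] at hxb hzb
      refine M₂.jointlyLarge x ?_ ?_
      · exact GTree.Enclosure.isLarge_inter_of_not_between M₂.minimal hcd hyc (M₂.enc x) (M₂.enc z)
          hx hz (fun hh => hxb (M₂.isIsolated_of_isomorphic hcd hh))
          (fun hh => hzb (M₂.isIsolated_of_isomorphic hcd hh))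
      · rw [← hsx] at hx hxb hzb
        exact GTree.Enclosure.isLarge_inter_of_not_between M₂.minimal hcd hyc (M₂.enc x).swap
          (M₂.enc z) hx hz (fun hh => hxb (M₂.isIsolated_of_isomorphic hcd hh))
          (fun hh => hzb (M₂.isIsolated_of_isomorphic hcd hh))
    have hxb : Splitting.IsIsolated σ x.1 →
        ¬ Between T₂.graph (M₂.place y) (M₂.place x) (M₂.place z) := fun hi =>
      hI' x hi (between_right _ _)
    have hzb : Splitting.IsIsolated σ z.1 →
        ¬ Between T₂.graph (M₂.place y) (M₂.place z) (M₂.place x) := fun hi hb =>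
      hI' z hi hb (between_right _ _)
    have hJx := hxz hxc hzc hxb hzb
    have hJz := hxz hzc hxc hzb hxb
    have hJy := M₂.jointlyLarge_of_not_isomorphic y hcd.symm ((mem_half_swap T₂.isTree hcd).2 hyc)
      (fun hh => hy (M₂.isIsolated_of_isomorphic hcd.symm hh))
    -- insert the edge `{c, d}` at a vertex of the other color of the first tree
    obtain ⟨v, hv, henc⟩ := hV₁ (T₂.toGTree.edgeSplitting M₂.minimal hcd) fun j =>
      GTree.edgeSplitting_compatible (M₂.E j) M₂.minimal hcd
    have hself : s(c, d) ∈ T₂.toGTree.edgeOrbit c d := ⟨1, by simp⟩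
    obtain ⟨F, hFa, hFb, g, hg⟩ := GTree.Enclosure.exists_of_encloses henc
      ((T₂.toGTree.edgeSplitting_isCollapse M₂.minimal hcd).map_adj hcd fun h => h hself)
    have hFv : ∀ (p : J × G) (g : G), g • F.vertex ≠ M₁.place p := by
      intro p
      refine M₁.smul_ne (fun hc => hv ?_) p
      rw [hg] at hc
      exact (T₁.smul_mem g v).1 hc
    obtain ⟨lx, hlx⟩ := F.hπ.surjective (M₁.place x)
    obtain ⟨ly, hly⟩ := F.hπ.surjective (M₁.place y)
    obtain ⟨lz, hlz⟩ := F.hπ.surjective (M₁.place z)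
    have hside : ∀ {p : J × G} {l : F.R.V}, F.π l = M₁.place p →
        JointlyLarge G (half T₂.graph c d)
            (half (σ p.1).graph (p.2 • s p.1) (p.2 • t p.1)) ∧
          JointlyLarge G (half T₂.graph c d)
            (half (σ p.1).graph (p.2 • t p.1) (p.2 • s p.1)) →
        l ∈ half F.R.graph F.a F.b := by
      intro p l hl hJ
      rw [← M₁.enc_ρ_a, ← M₁.enc_ρ_b] at hJ
      refine F.mem_half_of_jointlyLarge M₂.minimal hcd hcd hself hFa hFb (M₁.enc p) hJ.1 hJ.2 ?_ ?_
      · rw [hl, M₁.enc_vertex]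
      · intro g; rw [hl]; exact hFv p g
    have hlyb : ly ∈ half F.R.graph F.b F.a := by
      rw [← M₁.enc_ρ_a, ← M₁.enc_ρ_b] at hJy
      refine F.swap.mem_half_of_jointlyLarge M₂.minimal hcd.symm hcd ?_ hFb hFa (M₁.enc y)
        hJy.1 hJy.2 ?_ ?_
      · rw [Sym2.eq_swap]; exact hself
      · exact hly.trans (M₁.enc_vertex y).symm
      · intro g
        rw [F.vertex_swap]
        exact fun hc => hFv y g (hc.trans hly)
    obtain ⟨k, hk, hsub⟩ := F.exists_adj_of_mem_half (fun g => by rw [hly]; exact hFv y g) hlyb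
    have hxk := hsub lx (hside hlx hJx)
    have hzk := hsub lz (hside hlz hJz)
    rw [hly] at hk hxk hzk
    rw [hlx] at hxk
    rw [hlz] at hzk
    exact notMem_half_of_mem T₁.isTree hk.symm (h _ _ hk.symm hxk hzk)

end Marking

/-- The places of the members of the family can be chosen so that they exhaust the `V₀`-vertices:
the isolated vertices by the given bijection, the others because a member that is not isolated has
only one place. -/
theorem IsAlgebraicRegularNeighborhood.exists_marking {σ : J → Splitting G} {T : BipartiteGTree G}
    (h : T.IsAlgebraicRegularNeighborhood σ) (s t : ∀ j, (σ j).V)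
    (hst : ∀ j, (σ j).graph.Adj (s j) (t j)) : Nonempty (Marking σ s t T) := by
  obtain ⟨f, hf, hfenc⟩ := h.isolated
  have key : ∀ j, ∃ E : GTree.Enclosure T.toGTree (σ j), E.ρ E.a = s j ∧ E.ρ E.b = t j ∧
      E.vertex ∈ T.V₀ ∧ (∀ hj : Splitting.IsIsolated σ j,
        E.vertex ∈ (f ⟨j, hj⟩ : Set T.V) ∧ T.HasTwoFixedNeighbors E.vertex) := by
    intro j
    by_cases hj : Splitting.IsIsolated σ j
    · obtain ⟨v, hv, hviso, hO⟩ := (f ⟨j, hj⟩).2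
      obtain ⟨E, ha, hb, g, hg⟩ := GTree.Enclosure.exists_of_encloses
        (hfenc ⟨j, hj⟩ v (hO ▸ MulAction.mem_orbit_self v)) (hst j)
      refine ⟨E, ha, hb, ?_, fun _ => ⟨?_, ?_⟩⟩
      · rw [hg]; exact (T.smul_mem g v).2 hv
      · rw [hO, hg]; exact MulAction.mem_orbit v g
      · rw [hg]; exact hviso.hasTwoFixedNeighbors.smul g
    · obtain ⟨v, hv, henc⟩ := h.enclosed_V₀ j
      obtain ⟨E, ha, hb, g, hg⟩ := GTree.Enclosure.exists_of_encloses henc (hst j)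
      refine ⟨E, ha, hb, ?_, fun hj' => absurd hj' hj⟩
      rw [hg]; exact (T.smul_mem g v).2 hv
  choose E ha hb hmem hE using key
  refine ⟨⟨h.minimal, E, ha, hb, hmem, fun j hj => (hE j hj).2, fun v hv => ?_⟩⟩
  by_cases hviso : T.IsIsolatedVertex v
  · obtain ⟨⟨j, hj⟩, hfj⟩ := hf.2 ⟨MulAction.orbit G v, v, hv, hviso, rfl⟩
    have hmem := (hE j hj).1
    rw [hfj] at hmem
    obtain ⟨g, hg⟩ := hmem
    refine ⟨j, g⁻¹, ?_⟩
    rw [← hg]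
    exact (inv_smul_smul g v).symm
  · -- a splitting that is not isolated is enclosed in only one place
    obtain ⟨j, hj, henc⟩ := h.non_isolated v hv hviso
    obtain ⟨E', ha', hb', g, hg⟩ := GTree.Enclosure.exists_of_encloses henc (hst j)
    have heq := GTree.Enclosure.vertex_eq_of_edge_eq h.minimal
      (fun hcd hiso => hj
        (Splitting.IsIsolated.of_isomorphic h.minimal (fun j => ⟨E j⟩) hcd hiso))
      (E j) E' (ha'.trans (ha j).symm) (hb'.trans (hb j).symm)
    refine ⟨j, g⁻¹, ?_⟩
    rw [heq, hg, inv_smul_smul]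

end BipartiteGTree

theorem theorem9p1 {G : Type u} [Group G] {J : Type w} (σ : J → Splitting G)
    (hσ : ∀ j k : J, j ≠ k → ¬ GTree.Isomorphic (σ j).toGTree (σ k).toGTree)
    (hsand : Splitting.SatisfiesSandwiching σ)
    (T₁ T₂ : BipartiteGTree G)
    (h₁ : T₁.IsAlgebraicRegularNeighborhood σ)
    (h₂ : T₂.IsAlgebraicRegularNeighborhood σ) :
    ∃ φ : T₁.graph ≃g T₂.graph,
      GTree.IsEquivariant (T := T₁.toGTree) (T' := T₂.toGTree) φ ∧
        ∀ v : T₁.V, v ∈ T₁.V₀ ↔ φ v ∈ T₂.V₀ := by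
  choose s t hst using fun j => (σ j).exists_edge
  obtain ⟨M₁⟩ := h₁.exists_marking s t hst
  obtain ⟨M₂⟩ := h₂.exists_marking s t hst
  have hcor : BipartiteGTree.Correspondence T₁ T₂
      (fun v v' => ∃ x : J × G, v = M₁.place x ∧ v' = M₂.place x) :=
    { mem_left := by rintro _ _ ⟨x, rfl, -⟩; exact M₁.place_mem x
      mem_right := by rintro _ _ ⟨x, -, rfl⟩; exact M₂.place_mem x
      total_left := fun v hv => by
        obtain ⟨j, g, rfl⟩ := M₁.surj v hv
        exact ⟨_, (j, g), rfl, rfl⟩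
      total_right := fun v hv => by
        obtain ⟨j, g, rfl⟩ := M₂.surj v hv
        exact ⟨_, (j, g), rfl, rfl⟩
      smul := by
        rintro g _ _ ⟨x, rfl, rfl⟩
        exact ⟨(x.1, g * x.2), (mul_smul _ _ _).symm, (mul_smul _ _ _).symm⟩
      between := by
        rintro _ _ _ _ _ _ ⟨x, rfl, rfl⟩ ⟨y, rfl, rfl⟩ ⟨z, rfl, rfl⟩
        exact ⟨M₁.between_imp M₂ hσ h₁.enclosed_V₁, M₂.between_imp M₁ hσ h₂.enclosed_V₁⟩ }
  exact hcor.exists_isomorphism h₁.minimal h₂.minimal
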